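/- Work in $\mathbb{C}[\mathbf{x}]=\mathbb{C}[x_1,\dots,x_n]$. For $S\subset\{1,\dots,n\}$ let $\overline S$ be its complement, and for a set $T$ of polynomials let $Z(T)\subset\mathbb{C}^n$ be its zero set. A triangular set is $\Delta=\{g_1(\mathbf y,z_1),\dots,g_m(\mathbf y,z_1,\dots,z_m)\}$, where the variables $x_1,\dots,x_n$ are split into free variables $\mathbf y$ and leaders $z_1,\dots,z_m$ and $g_k$ involves $z_k$; $\mathrm{lc}(g_k)$ is its leading coefficient in $z_k$, $\mathcal I(\Delta)=(\Delta):\big(\prod_k \mathrm{lc}(g_k)\big)^\infty$ and $\mathrm{Rep}(\Delta)=Z(\mathcal I(\Delta))$. It is a regular chain if $\deg_{z_i}g_j<\deg_{z_i}g_i$ for $i<j$ and $\mathrm{lc}(g_k)$ is not a zero divisor in $R_k=\mathbb{C}[\mathbf y,z_1,\dots,z_{k-1}]/\mathcal I(g_1,\dots,g_{k-1})$ for all $k$; it is square-free if moreover each $g_k$ is square-free as a polynomial in $z_k$ over the total ring of fractions of $R_k$. Let $W=Z(f_1,\dots,f_s)\ne\emptyset$, and let $d_0$ and $d_1$ be the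 minimal and maximal dimensions of its irreducible components. Consider a run of the following algorithm. 1. For $d_0\le d\le d_1$, polynomials $\mathbf p_d=\{p_{d,0},\dots,p_{d,n}\}$ are given such that $Z(\mathbf p_d)$ is the union of the irreducible components of $W$ of dimension $d$. 2. Choose complex numbers $\lambda_{i,j}$ and put $\widetilde f_i=\sum_j\lambda_{i,j}f_j$ for $1\le i\le n-d_0+1$. 3. For $S\subset\{1,\dots,n\}$ with $n-d_1-1\le|S|=m-1\le n-d_0-1$ let $\hat g_S=\mathrm{PRes}_{\mathbf x_S}(\widetilde f_1,\dots,\widetilde f_m)\in\mathbb{C}[\mathbf x_{\overline S}]$ be Canny's generalized resultant: homogenize $\widetilde f_1,\dots,\widetilde f_m$ in the variables $\mathbf x_S=(x_{i_1},\dots,x_{i_{m-1}})$, $i_1<\dots<i_{m-1}$, by a new variable $x_0$, using the degrees $\delta_k=\max(1,\deg_{\mathbf x_S}\widetilde f_k)$; subtract $\sigma x_{i_k}^{\delta_k}$ from the $k$-th form for $k<m$ and $\sigma x_0^{\delta_m}$ from the $m$-th, where $\sigma$ is a new variable; then $\hat g_S$ is the coefficient of the lowest power of $\sigma$ that occurs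 in the multivariate resultant of these $m$ forms in $m$ variables. (The multivariate resultant is the equation, unique up to a nonzero constant, of the hypersurface of systems of $m$ forms of degrees $\delta_1,\dots,\delta_m$ in $m$ variables that have a nontrivial common zero.) 4. Choose $\boldsymbol\alpha\in\mathbb{C}^n$. For $S=\{i_1<\dots<i_m\}$ with $n-d_1\le m\le n-d_0$ and $1\le j\le m$, let $g_{S,j}$ be a squarefree part (involving no new variables) of $\hat g_{S\setminus\{i_j\}}(\alpha_1,\dots,\alpha_{i_j-1},x_{i_j},\dots,x_n)$, considered as a univariate polynomial in $x_{i_j}$ over $\mathbb{C}(\mathbf x_{\overline S})$. Put $\nabla_S=\{g_{S,1},\dots,g_{S,m}\}$. 5. For each such $S$, with $d=n-|S|$, add to the output the chains returned by $\mathrm{TriangularZeroDim}(S,\nabla_S\cup\mathbf p_d)$. This subroutine meets the following specification. If the ideal $I$ generated by the input polynomials in $\mathbb{C}(\mathbf x_{\overline S})[\mathbf x_S]$ is zero-dimensional (the unit ideal is allowed), and the Jacobian matrix of $\nabla_S$ with respect to $\mathbf x_S$ is invertible at every solution of $I$ over the algebraic closure of $\mathbb{C}(\mathbf x_{\overline S})$,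 then it returns finitely many square-free regular chains $\Delta_1,\dots,\Delta_q$, each with set of leaders $\mathbf x_S$, such that $\mathrm{Rep}(\Delta_i)$ and $\mathrm{Rep}(\Delta_j)$ have no common irreducible component for $i\ne j$; $\bigcap_i\mathcal I(\Delta_i)\cdot\mathbb{C}(\mathbf x_{\overline S})[\mathbf x_S]=\sqrt I$; and for each $g\in\Delta_i$ the coefficients of $g$, considered as a polynomial in $\mathbf x_S$, are coprime. Let $\Delta_1,\dots,\Delta_N$ be the whole output. Assume that (A1) for every $d\le n-1$ with $n-d\le n-d_0+1$ (so that $\widetilde f_1,\dots,\widetilde f_{n-d}$ are defined), $Z(\widetilde f_1,\dots,\widetilde f_{n-d})$ and $W$ have the same irreducible components of dimension larger than $d$; (A2) $\hat g_S(\boldsymbol\alpha)\ne0$ for every $S$ in step 3. Then for every irreducible component $C$ of $W$ there is exactly one $i\in\{1,\dots,N\}$ with $C\subset\mathrm{Rep}(\Delta_i)$. Moreover, $C$ is an irreducible component of $\mathrm{Rep}(\Delta_i)$, and the free variables of $\Delta_i$ form the lexicographically maximal transcendence basis for $C$: among all tuples $j_1<\dots<j_d$ such that $x_{j_1},\dots,x_{j_d}$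 is a transcendence basis of $\mathbb{C}[\mathbf x]$ modulo $I(C)$, the tuple of the indices of the free variables of $\Delta_i$ is lexicographically maximal. -/

import Mathlib

noncomputable section

namespace TriDec

/-- The polynomial ring `ℂ[x₁, …, xₙ]`; the variables are indexed by `Fin n` in increasing order. -/
abbrev Poly (n : ℕ) : Type := MvPolynomial (Fin n) ℂ

/-! ### Affine varieties -/

/-- The set of common zeros of a set of polynomials. -/
def zeros {n : ℕ} (T : Set (Poly n)) : Set (Fin n → ℂ) :=
  {x | ∀ p ∈ T, MvPolynomial.eval x p = 0}

/-- The ideal `I(V)` of the polynomials vanishing on `V`. -/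
abbrev idealOf {n : ℕ} (V : Set (Fin n → ℂ)) : Ideal (Poly n) :=
  MvPolynomial.vanishingIdeal ℂ V

/-- Algebraic (Zariski closed) sets. -/
def IsAlgebraicSet {n : ℕ} (V : Set (Fin n → ℂ)) : Prop :=
  ∃ T : Set (Poly n), V = zeros T

/-- Irreducible algebraic sets (in particular nonempty). -/
def IsIrreducibleVariety {n : ℕ} (C : Set (Fin n → ℂ)) : Prop :=
  IsAlgebraicSet C ∧ C.Nonempty ∧
    ∀ A B : Set (Fin n → ℂ), IsAlgebraicSet A → IsAlgebraicSet B → C ⊆ A ∪ B → C ⊆ A ∨ C ⊆ B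

/-- `C` is an irreducible component of `V`: a maximal irreducible algebraic subset of `V`. -/
def IsComponent {n : ℕ} (C V : Set (Fin n → ℂ)) : Prop :=
  Maximal (fun A => IsIrreducibleVariety A ∧ A ⊆ V) C

/-- The coordinate ring `ℂ[x] / I(C)`. -/
abbrev CoordRing {n : ℕ} (C : Set (Fin n → ℂ)) : Type := Poly n ⧸ idealOf C

/-- `dim C = d`, for an irreducible variety `C`: the transcendence degree of its coordinate ring
over `ℂ` is `d`. -/
def HasDim {n : ℕ} (C : Set (Fin n → ℂ)) (d : ℕ) : Prop :=
  Algebra.trdeg ℂ (CoordRing C) = (d : Cardinal)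

/-- The set of dimensions of the irreducible components of `V`. -/
def componentDims {n : ℕ} (V : Set (Fin n → ℂ)) : Set ℕ :=
  {d | ∃ C, IsComponent C V ∧ HasDim C d}

/-- The union of the irreducible components of dimension `d` of `V`. -/
def equidimPart {n : ℕ} (V : Set (Fin n → ℂ)) (d : ℕ) : Set (Fin n → ℂ) :=
  {x | ∃ C, IsComponent C V ∧ HasDim C d ∧ x ∈ C}

/-- The images of the variables `x_b`, `b ∈ B`, form a transcendence basis of `ℂ[x]` modulo
`I(C)`. -/
def IsTransBasis {n : ℕ} (C : Set (Fin n → ℂ)) (B : Finset (Fin n)) : Prop :=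
  IsTranscendenceBasis ℂ
    (fun b : B => (Ideal.Quotient.mk (idealOf C) (MvPolynomial.X b.1) : CoordRing C))

/-- Among all sets of variables that are transcendence bases modulo `I(C)`, the set `B`, written
as an increasing tuple, is lexicographically maximal. -/
def IsLexMaxTransBasis {n : ℕ} (C : Set (Fin n → ℂ)) (B : Finset (Fin n)) : Prop :=
  IsTransBasis C B ∧
    ∀ B' : Finset (Fin n), IsTransBasis C B' → B'.sort (· ≤ ·) ≤ B.sort (· ≤ ·)

/-! ### Coefficients with respect to some of the variables -/

/-- The coefficient in `ℂ[x_{Sᶜ}]` of the monomial `∏_{i ∈ S} x_i ^ (b i)` in `p`, where `p` is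
viewed as a polynomial in the variables `x_S`. -/
def coeffIn {n : ℕ} (S : Finset (Fin n)) (b : Fin n → ℕ) (p : Poly n) : Poly n :=
  ∑ m ∈ p.support with ∀ i ∈ S, m i = b i,
    MvPolynomial.monomial (m.filter (fun i => i ∉ S)) (p.coeff m)

/-- The leading coefficient of `p` viewed as a univariate polynomial in `x_i`. -/
def leadCoeffIn {n : ℕ} (i : Fin n) (p : Poly n) : Poly n :=
  coeffIn {i} (fun _ => p.degreeOf i) p

/-- The degree of `p` in the variables `x_S`. -/
def degreeIn {n : ℕ} (S : Finset (Fin n)) (p : Poly n) : ℕ :=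
  p.support.sup (fun m => ∑ i ∈ S, m i)

/-! ### Triangular sets and regular chains -/

/-- The saturation `I : h^∞`. -/
def saturation {R : Type*} [CommRing R] (I : Ideal R) (h : R) : Ideal R where
  carrier := {p | ∃ N : ℕ, h ^ N * p ∈ I}
  zero_mem' := ⟨0, by simp⟩
  add_mem' := by
    rintro a b ⟨N, hN⟩ ⟨M, hM⟩
    refine ⟨N + M, ?_⟩
    have e : h ^ (N + M) * (a + b) = h ^ M * (h ^ N * a) + h ^ N * (h ^ M * b) := by ring
    rw [e]
    exact I.add_mem (I.mul_mem_left _ hN) (I.mul_mem_left _ hM)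
  smul_mem' := by
    rintro c a ⟨N, hN⟩
    refine ⟨N, ?_⟩
    have e : h ^ N * (c • a) = c * (h ^ N * a) := by simp only [smul_eq_mul]; ring
    rw [e]
    exact I.mul_mem_left _ hN

/-- A triangular set `{g₁(y, z₁), g₂(y, z₁, z₂), …, g_m(y, z₁, …, z_m)}`, where the variables
`x₁, …, xₙ` are split into the leaders `z₁, …, z_m` (listed in any order) and the free variables
`y`, and `g_k` involves `z_k`. -/
structure TriangularSet (n : ℕ) where
  m : ℕ
  z : Fin m ↪ Fin n
  g : Fin m → Poly n
  not_mem_vars : ∀ k j, k < j → z j ∉ (g k).vars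
  leader_mem_vars : ∀ k, z k ∈ (g k).vars

namespace TriangularSet

variable {n : ℕ} (Δ : TriangularSet n)

/-- The set of (indices of) the leaders. -/
def leaders : Finset (Fin n) := Finset.univ.map Δ.z

/-- The set of (indices of) the free variables. -/
def freeVars : Finset (Fin n) := Δ.leadersᶜ

/-- The leading coefficient `lc(g_k)` with respect to the leader `z_k`. -/
def lc (k : Fin Δ.m) : Poly n := leadCoeffIn (Δ.z k) (Δ.g k)

/-- The saturated ideal generated in `ℂ[x]` by the first `k` elements of the triangular set. -/
def satIdealUpTo (k : ℕ) : Ideal (Poly n) :=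
  saturation (Ideal.span {p | ∃ j : Fin Δ.m, (j : ℕ) < k ∧ p = Δ.g j})
    (∏ j ∈ Finset.univ.filter (fun j : Fin Δ.m => (j : ℕ) < k), Δ.lc j)

/-- The saturated ideal `𝓘(Δ) = (Δ) : I_Δ^∞`. -/
def satIdeal : Ideal (Poly n) := Δ.satIdealUpTo Δ.m

/-- `Rep(Δ) = Z(𝓘(Δ))`. -/
def Rep : Set (Fin n → ℂ) := zeros (Δ.satIdeal : Set (Poly n))

/-- The variables `y, z₁, …, z_{k-1}`, i.e. all variables but `z_k, …, z_m`. -/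
abbrev LowerVar (k : Fin Δ.m) : Type := {v : Fin n // ∀ j, k ≤ j → v ≠ Δ.z j}

/-- The ring `ℂ[y, z₁, …, z_{k-1}] / 𝓘(g₁, …, g_{k-1})`. -/
abbrev LowerRing (k : Fin Δ.m) : Type :=
  MvPolynomial (Δ.LowerVar k) ℂ ⧸
    (Δ.satIdealUpTo k).comap
      (MvPolynomial.rename (R := ℂ) (Subtype.val : Δ.LowerVar k → Fin n))

open Classical in
/-- The image in `ℂ[y, z₁, …, z_{k-1}] / 𝓘(g₁, …, g_{k-1})` of a polynomial in
`y, z₁, …, z_{k-1}` (the other variables are sent to `0`). -/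
def toLowerRing (k : Fin Δ.m) : Poly n →+* Δ.LowerRing k :=
  (Ideal.Quotient.mk _).comp
    (MvPolynomial.aeval (R := ℂ) (fun v : Fin n =>
      if h : ∀ j, k ≤ j → v ≠ Δ.z j then
        (MvPolynomial.X ⟨v, h⟩ : MvPolynomial (Δ.LowerVar k) ℂ) else 0)).toRingHom

/-- A polynomial in `y, z₁, …, z_k` as a univariate polynomial in `z_k` over the total ring of
fractions of `ℂ[y, z₁, …, z_{k-1}] / 𝓘(g₁, …, g_{k-1})`. -/
def toUnivariate (k : Fin Δ.m) : Poly n →+* Polynomial (FractionRing (Δ.LowerRing k)) :=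
  MvPolynomial.eval₂Hom
    ((Polynomial.C.comp (algebraMap (Δ.LowerRing k) (FractionRing (Δ.LowerRing k)))).comp
      ((Δ.toLowerRing k).comp MvPolynomial.C))
    (fun v => if v = Δ.z k then Polynomial.X else
      Polynomial.C (algebraMap (Δ.LowerRing k) (FractionRing (Δ.LowerRing k))
        (Δ.toLowerRing k (MvPolynomial.X v))))

/-- Regular chains. -/
def IsRegularChain : Prop :=
  (∀ i j, i < j → (Δ.g j).degreeOf (Δ.z i) < (Δ.g i).degreeOf (Δ.z i)) ∧
  ∀ k, Δ.toLowerRing k (Δ.lc k) ∈ nonZeroDivisors (Δ.LowerRing k)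

/-- Square-free regular chains. -/
def IsSquarefreeRegularChain : Prop :=
  Δ.IsRegularChain ∧ ∀ k, Squarefree (Δ.toUnivariate k (Δ.g k))

end TriangularSet

/-! ### The multivariate resultant and Canny's generalized (perturbed) resultant -/

section Resultant

variable {ι : Type} [Fintype ι] [DecidableEq ι]

/-- Indices of the coefficients of a generic system of forms `(F_i)_{i ∈ ι}`, in the variables
`(X_j)_{j ∈ ι}`, where `F_i` is homogeneous of degree `d i`: pairs of an index `i` and an exponent
of degree `d i`. -/
abbrev CoeffIndex (d : ι → ℕ) : Type :=
  Σ i : ι, {a : ι →₀ ℕ // a ∈ (Finset.univ : Finset ι).finsuppAntidiag (d i)}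

/-- The systems (given by their coefficients) of as many forms as variables, of degrees `d`,
that have a nontrivial common zero. -/
def solvableSystems (d : ι → ℕ) : Set (CoeffIndex d → ℂ) :=
  {c | ∃ x : ι → ℂ, x ≠ 0 ∧ ∀ i, ∑ a, c ⟨i, a⟩ * ∏ j, x j ^ a.1 j = 0}

open Classical in
/-- The multivariate resultant of forms of degrees `d`, a polynomial in the coefficients of the
forms: the equation (unique up to a nonzero constant factor) of the hypersurface of the systems
with a nontrivial common zero, i.e. the generator of its ideal, which is principal as soon as
`ι` is nonempty and all the degrees are positive. -/
def resultant (d : ι → ℕ) : MvPolynomial (CoeffIndex d) ℂ :=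
  if h : (MvPolynomial.vanishingIdeal ℂ (solvableSystems d)).IsPrincipal then
    h.generator
  else 0

end Resultant

/-- The degree in which `p` is homogenized with respect to the variables `x_S`. -/
def formDegree {n : ℕ} (S : Finset (Fin n)) (p : Poly n) : ℕ := max 1 (degreeIn S p)

open Classical in
/-- The coefficients of the perturbed system. The `|S| + 1` polynomials `F` are homogenized with
respect to the variables `x_S` by a new variable (index `none`); the form coming from `F o` is
then replaced by itself minus `s * (variable o) ^ (its degree)`, where `s` is the variable of
`Polynomial (Poly n)`. -/
def perturbedCoeff {n : ℕ} (S : Finset (Fin n)) (F : Option S → Poly n)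
    (t : CoeffIndex (fun o => formDegree S (F o))) : Polynomial (Poly n) :=
  Polynomial.C
      (coeffIn S (fun i => if h : i ∈ S then t.2.1 (some ⟨i, h⟩) else 0) (F t.1)) -
    if t.2.1 = Finsupp.single t.1 (formDegree S (F t.1)) then Polynomial.X else 0

/-- Canny's generalized resultant `PRes_{x_S}(F) ∈ ℂ[x_{Sᶜ}] ⊆ ℂ[x]`: the trailing coefficient,
with respect to the perturbation variable `s`, of the resultant of the perturbed system. -/
def PRes {n : ℕ} (S : Finset (Fin n)) (F : Option S → Poly n) : Poly n :=
  (MvPolynomial.eval₂ (Polynomial.C.comp MvPolynomial.C) (perturbedCoeff S F)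
    (resultant (fun o => formDegree S (F o)))).trailingCoeff

/-! ### Zero-dimensional triangular decomposition over fraction fields -/

/-- The field `ℂ(x_{Sᶜ})`. -/
abbrev FracField {n : ℕ} (S : Finset (Fin n)) : Type :=
  FractionRing (MvPolynomial {i : Fin n // i ∉ S} ℂ)

/-- The inclusion `ℂ[x] → ℂ(x_{Sᶜ})[x_S]`. -/
def toFrac {n : ℕ} (S : Finset (Fin n)) :
    Poly n →+* MvPolynomial {i : Fin n // i ∈ S} (FracField S) :=
  MvPolynomial.eval₂Hom
    ((MvPolynomial.C.comp (algebraMap (MvPolynomial {i : Fin n // i ∉ S} ℂ) (FracField S))).comp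
      MvPolynomial.C)
    (fun i => if h : i ∈ S then MvPolynomial.X ⟨i, h⟩ else
      MvPolynomial.C (algebraMap (MvPolynomial {i : Fin n // i ∉ S} ℂ) (FracField S)
        (MvPolynomial.X ⟨i, h⟩)))

/-- The ideal of `ℂ(x_{Sᶜ})[x_S]` generated by the polynomials `h_i`, `i ∈ S`, and `P`. -/
def fracIdeal {n : ℕ} (S : Finset (Fin n)) (h : Fin n → Poly n) (P : Set (Poly n)) :
    Ideal (MvPolynomial {i : Fin n // i ∈ S} (FracField S)) :=
  Ideal.span (toFrac S '' (h '' (S : Set (Fin n)) ∪ P))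

/-- The input specification of `TriangularZeroDim` for the set `S` and the polynomials
`h_i`, `i ∈ S` (these are the first `|S|` polynomials), followed by `P`. -/
def TriangularZeroDimInput {n : ℕ} (S : Finset (Fin n)) (h : Fin n → Poly n)
    (P : Set (Poly n)) : Prop :=
  Module.Finite (FracField S)
    (MvPolynomial {i : Fin n // i ∈ S} (FracField S) ⧸ fracIdeal S h P) ∧
  ∀ x : {i : Fin n // i ∈ S} → AlgebraicClosure (FracField S),
    (∀ p ∈ fracIdeal S h P, MvPolynomial.aeval x p = 0) →
    IsUnit (Matrix.of (fun i j : {i : Fin n // i ∈ S} =>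
      MvPolynomial.aeval x (MvPolynomial.pderiv j (toFrac S (h i)))))

/-- The output specification of `TriangularZeroDim`. In the last condition, an element of
`ℂ[x_{Sᶜ}]` is a common divisor of the coefficients of `g`, viewed as a polynomial in `x_S`, if
and only if it divides `g`. -/
def TriangularZeroDimOutput {n : ℕ} (S : Finset (Fin n)) (h : Fin n → Poly n)
    (P : Set (Poly n)) {q : ℕ} (Δ : Fin q → TriangularSet n) : Prop :=
  (∀ j, (Δ j).IsSquarefreeRegularChain) ∧
  (∀ j, (Δ j).leaders = S) ∧
  (∀ i j, i ≠ j → ¬ ∃ C, IsComponent C (Δ i).Rep ∧ IsComponent C (Δ j).Rep) ∧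
  (⨅ j, (Δ j).satIdeal.map (toFrac S)) = (fracIdeal S h P).radical ∧
  (∀ j k, ∀ a : Poly n, (∀ i ∈ a.vars, i ∉ S) → a ∣ (Δ j).g k → IsUnit a)

/-! ### The main algorithm -/

/-- The `k`-th random linear combination of the input polynomials (`k = 0, 1, 2, …`). -/
def squared {n s : ℕ} (f : Fin s → Poly n) (lam : ℕ → Fin s → ℂ) (k : ℕ) : Poly n :=
  ∑ j, MvPolynomial.C (lam k j) * f j

/-- `ĝ_S = PRes_{x_S}(f̃₁, …, f̃_m)` with `m = |S| + 1`. The polynomials `f̃₁, …, f̃_{m-1}` are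
attached, in order, to the variables in `S`, and `f̃_m` to the homogenizing variable. -/
def ghat {n s : ℕ} (f : Fin s → Poly n) (lam : ℕ → Fin s → ℂ) (S : Finset (Fin n)) : Poly n :=
  PRes S (fun o => squared f lam (o.elim S.card (fun i => (S.filter (· < i.1)).card)))

/-- `p(α₁, …, α_{i-1}, x_i, …, x_n)`. -/
def specialize {n : ℕ} (α : Fin n → ℂ) (i : Fin n) (p : Poly n) : Poly n :=
  MvPolynomial.bind₁ (fun l => if l < i then MvPolynomial.C (α l) else MvPolynomial.X l) p

/-- `g` is a squarefree part of `p`, where both are considered as polynomials in the variables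
`x_S` (here: in just one of them) over the field `ℂ(x_{Sᶜ})`; `g` involves no new variables. -/
def IsSquarefreePart {n : ℕ} (S : Finset (Fin n)) (p g : Poly n) : Prop :=
  g.vars ⊆ p.vars ∧ Squarefree (toFrac S g) ∧ toFrac S g ∣ toFrac S p ∧
    ∃ N : ℕ, toFrac S p ∣ toFrac S g ^ N

end TriDec

end

/-!
The chain that represents a component `C` is found with the algebraic matroid of the variables
modulo `I(C)`. Its greedy basis `B`, obtained by running through the variables from `xₙ` down to
`x₁`, is the lexicographically maximal transcendence basis (`IsGreedy.sort_le`), and the chain has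
the leaders `x_S` with `S = Bᶜ`. The argument rests on three facts.

*Generalized resultants vanish on components* (`PRes_mem`, `ghat_mem`). Let `T` have one element
fewer than `S`. In `ℂⁿ⁺¹`, the zero set of the perturbed system has, by Krull's height theorem and
`card_le_height_add_quotDim`, only components of dimension greater than `dim C`. One of them
contains `{0} × C`; it does not lie in the hyperplane `s = 0`, for otherwise the squared system
would have a component of dimension greater than `dim C` around `C`, which the hypothesis on its
components excludes. The resultant divided by a power of `s` vanishes on it, and hence `ĝ_T`, the
value of this quotient at `s = 0`, vanishes on `C`. If `T = S \ {i}`, the specialization of the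
variables below `x_i` preserves this, as they are algebraically independent over the remaining
ones (`specialize_mem`). So all polynomials passed to the zero-dimensional subroutine vanish at the
generic point of `C`.

*The subroutine is called correctly* (`triangularZeroDimInput`), because `g_{S,i}` is a squarefree
univariate polynomial in `x_i` over `ℂ(x_{Sᶜ})`. Its output condition then translates, by evaluation
at generic points (`exists_isPrime_toFrac`), into inclusions between the saturated ideals of the
chains and prime ideals of `ℂ[x]`: some chain satisfies `𝓘(Δ) ≤ I(C)`.

*Saturated ideals of triangular sets are unmixed*
(`TriangularSet.isTranscendenceBasis_freeVars`): modulo every minimal prime, the free variables form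
a transcendence basis. So a component `C` inside `Rep(Δ)` is the zero set of a minimal prime of
`𝓘(Δ)`, the free variables of `Δ` are a transcendence basis for `C`, and the polynomials `g_{S,i}`,
which vanish on `C` and involve only `x_i` and larger free variables, show that this basis is the
greedy one. Hence `S` is determined by `C`, and chains with the same leaders share no component.
-/

noncomputable section

namespace TriDec

open MvPolynomial

/-! ### Heights and transcendence degrees of prime ideals -/

section Dimension

/-- The dimension of the affine variety with coordinate ring `A / P`: the transcendence degree over
`ℂ`, as a natural number (it is finite when `A` is a finitely generated algebra). -/
def quotDim {A : Type} [CommRing A] [Algebra ℂ A] (P : Ideal A) : ℕ :=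
  Cardinal.toNat (Algebra.trdeg ℂ (A ⧸ P))

lemma cast_quotDim {A : Type} [CommRing A] [Algebra ℂ A] [Algebra.FiniteType ℂ A] (P : Ideal A) :
    (quotDim P : Cardinal) = Algebra.trdeg ℂ (A ⧸ P) :=
  Cardinal.cast_toNat_of_lt_aleph0 trdeg_lt_aleph0_of_finiteType

/-- Dimensions do not grow along surjections of coordinate rings. -/
lemma quotDim_le_of_surjective {A B : Type} [CommRing A] [Algebra ℂ A] [Algebra.FiniteType ℂ A]
    [CommRing B] [Algebra ℂ B] [Algebra.FiniteType ℂ B] {P : Ideal A} {Q : Ideal B}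
    (φ : (A ⧸ P) →ₐ[ℂ] (B ⧸ Q)) (hφ : Function.Surjective φ) : quotDim Q ≤ quotDim P := by
  have := trdeg_le_of_surjective φ hφ
  rw [← cast_quotDim, ← cast_quotDim] at this
  exact_mod_cast this

lemma quotDim_anti {A : Type} [CommRing A] [Algebra ℂ A] [Algebra.FiniteType ℂ A]
    {P Q : Ideal A} (h : P ≤ Q) : quotDim Q ≤ quotDim P :=
  quotDim_le_of_surjective (Ideal.Quotient.factorₐ ℂ h) (Ideal.Quotient.factor_surjective h)

variable {σ : Type}

/-- For a prime ideal `P` with generic point `a = (a_i)`, the homomorphism `ℂ[x] → ℂ(a)[t]` which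
sends `x_j` to `t` and the other `x_i` to `a_i`. -/
def freeUp [DecidableEq σ] (P : Ideal (MvPolynomial σ ℂ)) [P.IsPrime] (j : σ) :
    MvPolynomial σ ℂ →ₐ[ℂ] Polynomial (FractionRing (MvPolynomial σ ℂ ⧸ P)) :=
  aeval (Function.update
    (fun i => Polynomial.C (algebraMap _ (FractionRing (MvPolynomial σ ℂ ⧸ P))
      (Ideal.Quotient.mk P (X i)))) j Polynomial.X)

lemma derivative_freeUp [DecidableEq σ] (P : Ideal (MvPolynomial σ ℂ)) [P.IsPrime] (j : σ)
    (p : MvPolynomial σ ℂ) :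
    Polynomial.derivative (freeUp P j p) = freeUp P j (pderiv j p) := by
  induction p using MvPolynomial.induction_on with
  | C a =>
    have : freeUp P j (C a) = Polynomial.C (algebraMap ℂ _ a) := by
      simp [freeUp, IsScalarTower.algebraMap_apply ℂ (FractionRing (MvPolynomial σ ℂ ⧸ P))
        (Polynomial (FractionRing (MvPolynomial σ ℂ ⧸ P)))]
    simp [this]
  | add p q hp hq => simp [hp, hq]
  | mul_X p i hp =>
    have hX : Polynomial.derivative (freeUp P j (X i)) = freeUp P j (pderiv j (X i)) := by
      by_cases h : i = j
      · subst h; simp [freeUp]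
      · rw [pderiv_X_of_ne h]; simp [freeUp, Function.update_of_ne h]
    rw [map_mul, Polynomial.derivative_mul, hp, hX, pderiv_mul, map_add, map_mul, map_mul]

lemma ker_freeUp_le [DecidableEq σ] (P : Ideal (MvPolynomial σ ℂ)) [P.IsPrime] (j : σ) :
    RingHom.ker (freeUp P j) ≤ P := by
  intro p hp
  set a := fun i => algebraMap _ (FractionRing (MvPolynomial σ ℂ ⧸ P)) (Ideal.Quotient.mk P (X i))
  have h : ((Polynomial.aeval (R := FractionRing (MvPolynomial σ ℂ ⧸ P)) (a j)).restrictScalars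
      ℂ).comp (freeUp P j) = (IsScalarTower.toAlgHom ℂ (MvPolynomial σ ℂ ⧸ P) _).comp
        (Ideal.Quotient.mkₐ ℂ P) := by
    ext i
    by_cases h : i = j
    · subst h; simp [freeUp, a]
    · simp [freeUp, a, Function.update_of_ne h]
  have h2 := congrArg (fun f => f p) h
  simp only [AlgHom.comp_apply, (RingHom.mem_ker).1 hp, map_zero] at h2
  have h3 : algebraMap (MvPolynomial σ ℂ ⧸ P) (FractionRing (MvPolynomial σ ℂ ⧸ P))
    (Ideal.Quotient.mk P p) = 0 := h2.symm
  rw [map_eq_zero_iff _ (IsFractionRing.injective _ _)] at h3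
  exact Ideal.Quotient.eq_zero_iff_mem.1 h3

lemma totalDegree_pderiv_lt {j : σ} {p : MvPolynomial σ ℂ} (h : pderiv j p ≠ 0) :
    (pderiv j p).totalDegree < p.totalDegree := by
  obtain ⟨m, hm, hm'⟩ := Finset.exists_mem_eq_sup _ (support_nonempty.2 h)
    (fun m => m.sum fun _ e => e)
  rw [mem_support_iff, coeff_pderiv] at hm
  have h1 : m + Finsupp.single j 1 ∈ p.support := mem_support_iff.2 (left_ne_zero_of_mul hm)
  have h2 := le_totalDegree h1
  rw [Finsupp.sum_add_index' (by simp) (by simp), Finsupp.sum_single_index rfl] at h2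
  have : (pderiv j p).totalDegree = m.sum fun _ e => e := hm'
  omega

lemma exists_ker_freeUp_lt [DecidableEq σ] (P : Ideal (MvPolynomial σ ℂ)) [P.IsPrime] (hP : P ≠ ⊥) :
    ∃ j, RingHom.ker (freeUp P j) < P := by
  by_contra! hcon
  have hker : ∀ j, RingHom.ker (freeUp P j) = P := fun j =>
    (ker_freeUp_le P j).eq_of_not_lt (hcon j)
  -- `P` would be stable under all partial derivatives, hence would contain a nonzero constant
  have hd : ∀ j, ∀ p ∈ P, pderiv j p ∈ P := by
    intro j p hp
    rw [← hker j, RingHom.mem_ker] at hp ⊢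
    rw [← derivative_freeUp, hp, map_zero]
  have key : ∀ k : ℕ, ∀ p ∈ P, p.totalDegree ≤ k → p = 0 := by
    intro k
    induction k with
    | zero =>
      intro p hp h0
      rw [totalDegree_eq_zero_iff_eq_C.1 (Nat.le_zero.1 h0)] at hp ⊢
      by_contra hne
      have hc : coeff 0 p ≠ 0 := fun h => hne (by rw [h, map_zero])
      exact Ideal.IsPrime.ne_top ‹_› (Ideal.eq_top_of_isUnit_mem _ hp
        ((isUnit_iff_ne_zero.2 hc).map C))
    | succ k ih =>
      intro p hp hk
      by_cases h : ∀ j, pderiv j p = 0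
      · refine ih p hp (le_trans (le_of_eq ?_) (Nat.zero_le k))
        rw [totalDegree_eq_zero_iff]
        intro m hm j
        by_contra hj
        have h1 := congrArg (coeff (m - Finsupp.single j 1)) (h j)
        have h2 : m - Finsupp.single j 1 + Finsupp.single j 1 = m :=
          tsub_add_cancel_of_le (by simpa using Nat.one_le_iff_ne_zero.2 hj)
        rw [coeff_pderiv, h2, coeff_zero] at h1
        rcases mul_eq_zero.1 h1 with h1 | h1
        · exact (mem_support_iff.1 hm) h1
        · exact absurd h1 (Nat.cast_add_one_ne_zero _)
      · push Not at h
        obtain ⟨j, hj⟩ := h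
        have := totalDegree_pderiv_lt hj
        exact absurd (ih _ (hd j p hp) (by omega)) hj
  exact hP (eq_bot_iff.2 fun p hp => key _ p hp le_rfl)

lemma trdeg_fractionRing (D : Type) [CommRing D] [IsDomain D] [Algebra ℂ D] :
    Algebra.trdeg ℂ (FractionRing D) = Algebra.trdeg ℂ D := by
  have : FaithfulSMul ℂ D := (faithfulSMul_iff_algebraMap_injective _ _).2
    (algebraMap ℂ D).injective
  have : Algebra.IsAlgebraic D (FractionRing D) :=
    IsLocalization.isAlgebraic _ (nonZeroDivisors D)
  rw [← trdeg_add_eq ℂ D (A := FractionRing D), trdeg_eq_zero (R := D), add_zero]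

lemma quotDim_ker_freeUp_le [DecidableEq σ] [Finite σ] (P : Ideal (MvPolynomial σ ℂ)) [P.IsPrime]
    (j : σ) : quotDim (RingHom.ker (freeUp P j)) ≤ quotDim P + 1 := by
  have h : Algebra.trdeg ℂ (MvPolynomial σ ℂ ⧸ RingHom.ker (freeUp P j)) ≤
      Algebra.trdeg ℂ (MvPolynomial σ ℂ ⧸ P) + 1 := by
    refine (trdeg_le_of_injective (Ideal.kerLiftAlg (freeUp P j))
      (Ideal.kerLiftAlg_injective _)).trans (le_of_eq ?_)
    rw [← trdeg_fractionRing (MvPolynomial σ ℂ ⧸ P),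
      ← trdeg_add_eq ℂ (FractionRing (MvPolynomial σ ℂ ⧸ P)), Polynomial.trdeg_of_isDomain]
  rw [← cast_quotDim, ← cast_quotDim] at h
  exact_mod_cast h

/-- The half of the dimension formula for affine varieties that bounds the dimension from below.
Freeing one coordinate of the generic point, as in `freeUp`, gives a smaller prime ideal whose
dimension has grown by at most one; this is iterated until the zero ideal is reached. -/
theorem card_le_height_add_quotDim [DecidableEq σ] [Fintype σ] (P : Ideal (MvPolynomial σ ℂ))
    [hP : P.IsPrime] : (Fintype.card σ : ℕ∞) ≤ P.height + quotDim P := by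
  obtain ⟨e, he⟩ : ∃ e, P.height = e := ⟨_, rfl⟩
  induction e using WellFoundedLT.induction generalizing P with
  | ind e ih =>
    by_cases hb : P = ⊥
    · subst hb
      rw [quotDim, (AlgEquiv.quotientBot ℂ (MvPolynomial σ ℂ)).trdeg_eq,
        MvPolynomial.trdeg_of_isDomain]
      simp
    obtain ⟨j, hj⟩ := exists_ker_freeUp_lt P hb
    have hprime : (RingHom.ker (freeUp P j)).IsPrime := RingHom.ker_isPrime _
    have h1 := quotDim_ker_freeUp_le P j
    have h2 := Ideal.height_add_one_le_of_lt_of_isPrime hj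
    have h3 := ih _ (he ▸ Ideal.height_strict_mono_of_isPrime hj) _ rfl
    calc (Fintype.card σ : ℕ∞) ≤ (RingHom.ker (freeUp P j)).height + (quotDim P + 1 : ℕ) :=
          h3.trans (by gcongr)
      _ = ((RingHom.ker (freeUp P j)).height + 1) + quotDim P := by push_cast; ring
      _ ≤ _ := by gcongr

/-- Every irreducible component of the common zeros of `m` polynomials in an affine space has
codimension at most `m`. The ring is only assumed to be isomorphic to a polynomial ring. -/
theorem card_le_ncard_add_quotDim [Fintype σ] {A : Type} [CommRing A] [Algebra ℂ A]
    (e : MvPolynomial σ ℂ ≃ₐ[ℂ] A) {s : Set A} (hs : s.Finite) {P : Ideal A}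
    (hP : P ∈ (Ideal.span s).minimalPrimes) : Fintype.card σ ≤ s.ncard + quotDim P := by
  classical
  have hprime := hP.isPrime
  have : IsNoetherianRing A := isNoetherianRing_of_ringEquiv _ e.toRingEquiv
  have h1 := Ideal.height_le_card_of_mem_minimalPrimes_span hs hP
  have h2 := card_le_height_add_quotDim (P.comap e.toRingEquiv)
  rw [RingEquiv.height_comap] at h2
  have h3 : quotDim (P.comap e.toRingEquiv) = quotDim P := by
    rw [quotDim, quotDim]
    congr 1
    refine AlgEquiv.trdeg_eq (Ideal.quotientEquivAlg _ _ e ?_)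
    exact (Ideal.map_comap_of_surjective e.toRingEquiv e.surjective P).symm
  rw [h3] at h2
  exact_mod_cast h2.trans (add_le_add_left h1 _)

end Dimension

/-! ### Irreducible varieties and prime ideals -/

section Geometry

variable {n : ℕ}

lemma mem_idealOf {V : Set (Fin n → ℂ)} {q : Poly n} :
    q ∈ idealOf V ↔ ∀ x ∈ V, eval x q = 0 := by
  simp [mem_vanishingIdeal_iff, aeval_eq_eval]

lemma subset_zeros_iff {V : Set (Fin n → ℂ)} {T : Set (Poly n)} :
    V ⊆ zeros T ↔ T ⊆ idealOf V :=
  ⟨fun h _ hq => mem_idealOf.2 fun _ hx => h hx _ hq,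
    fun h _ hx _ hq => mem_idealOf.1 (h hq) _ hx⟩

lemma zeros_anti {T T' : Set (Poly n)} (h : T ⊆ T') : zeros T' ⊆ zeros T :=
  fun _ hx _ hq => hx _ (h hq)

lemma zeros_span (T : Set (Poly n)) : zeros (Ideal.span T : Set (Poly n)) = zeros T := by
  refine (zeros_anti Ideal.subset_span).antisymm (subset_zeros_iff.2 ?_)
  exact Ideal.span_le.2 (subset_zeros_iff.1 subset_rfl)

lemma zeros_idealOf {V : Set (Fin n → ℂ)} (hV : IsAlgebraicSet V) :
    zeros (idealOf V : Set (Poly n)) = V := by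
  obtain ⟨T, rfl⟩ := hV
  exact (zeros_anti (subset_zeros_iff.1 subset_rfl)).antisymm (subset_zeros_iff.2 subset_rfl)

lemma idealOf_le_iff {V V' : Set (Fin n → ℂ)} (hV : IsAlgebraicSet V) :
    V' ⊆ V ↔ idealOf V ≤ idealOf V' := by
  conv_lhs => rw [← zeros_idealOf hV]
  exact subset_zeros_iff

lemma IsIrreducibleVariety.isPrime {C : Set (Fin n → ℂ)} (hC : IsIrreducibleVariety C) :
    (idealOf C).IsPrime := by
  obtain ⟨-, ⟨x, hx⟩, hirr⟩ := hC
  refine ⟨fun h => ?_, fun {p q} hpq => ?_⟩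
  · have : (1 : Poly n) ∈ idealOf C := h ▸ Submodule.mem_top
    simpa using mem_idealOf.1 this x hx
  · have h := hirr (zeros {p}) (zeros {q}) ⟨_, rfl⟩ ⟨_, rfl⟩ fun y hy => by
      have := mem_idealOf.1 hpq y hy
      rw [map_mul, mul_eq_zero] at this
      simpa [zeros] using this
    rw [subset_zeros_iff, subset_zeros_iff] at h
    simpa using h

lemma idealOf_zeros_radical (I : Ideal (Poly n)) :
    idealOf (zeros (I : Set (Poly n))) = I.radical := by
  rw [← vanishingIdeal_zeroLocus_eq_radical (K := ℂ)]
  congr 1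

lemma idealOf_zeros (P : Ideal (Poly n)) [hP : P.IsPrime] :
    idealOf (zeros (P : Set (Poly n))) = P :=
  (idealOf_zeros_radical P).trans hP.radical

lemma isIrreducibleVariety_zeros (P : Ideal (Poly n)) [hP : P.IsPrime] :
    IsIrreducibleVariety (zeros (P : Set (Poly n))) := by
  refine ⟨⟨_, rfl⟩, ?_, fun A B hA hB hAB => ?_⟩
  · rw [Set.nonempty_iff_ne_empty]
    intro h
    have := idealOf_zeros P
    rw [h, idealOf, vanishingIdeal_empty] at this
    exact hP.ne_top this.symm
  · rw [idealOf_le_iff hA, idealOf_le_iff hB, idealOf_zeros]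
    rw [← Ideal.IsPrime.inf_le hP]
    intro q hq
    rw [← idealOf_zeros P, mem_idealOf]
    intro x hx
    rcases hAB hx with h | h
    · exact mem_idealOf.1 hq.1 x h
    · exact mem_idealOf.1 hq.2 x h

lemma hasDim_iff {C : Set (Fin n → ℂ)} {d : ℕ} : HasDim C d ↔ quotDim (idealOf C) = d := by
  change Algebra.trdeg ℂ (Poly n ⧸ idealOf C) = d ↔ _
  rw [← cast_quotDim]
  exact Nat.cast_inj

lemma isComponent_zeros {T : Set (Poly n)} {P : Ideal (Poly n)}
    (hP : P ∈ (Ideal.span T).minimalPrimes) : IsComponent (zeros (P : Set (Poly n))) (zeros T) := by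
  have := hP.isPrime
  refine ⟨⟨isIrreducibleVariety_zeros P, ?_⟩, fun A ⟨hA, hAT⟩ hPA => ?_⟩
  · rw [← zeros_span T]
    exact zeros_anti (SetLike.coe_subset_coe.2 hP.le)
  · have hle : idealOf A ≤ P := by
      rw [← idealOf_zeros P]; exact (idealOf_le_iff hA.1).1 hPA
    have := hP.2 ⟨hA.isPrime, Ideal.span_le.2 (subset_zeros_iff.1 hAT)⟩ hle
    exact subset_zeros_iff.2 this

/-- A component contained in an irreducible subset is equal to it. -/
lemma IsComponent.eq_zeros {C V : Set (Fin n → ℂ)} (hC : IsComponent C V) {P : Ideal (Poly n)}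
    [P.IsPrime] (hPV : zeros (P : Set (Poly n)) ⊆ V) (hPC : P ≤ idealOf C) : idealOf C = P := by
  have h1 : C ⊆ zeros (P : Set (Poly n)) := subset_zeros_iff.2 hPC
  have h2 : zeros (P : Set (Poly n)) ⊆ C := hC.2 ⟨isIrreducibleVariety_zeros P, hPV⟩ h1
  rw [h1.antisymm h2, idealOf_zeros]

end Geometry

/-! ### Canny's generalized resultant -/

section GeneralizedResultant

variable {n : ℕ}

/-- The resultant vanishes on the systems with a nontrivial common zero, since it is either a
generator of their vanishing ideal or zero. -/
lemma resultant_eval_eq_zero {ι : Type} [Fintype ι] [DecidableEq ι] {d : ι → ℕ}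
    {c : CoeffIndex d → ℂ} (hc : c ∈ solvableSystems d) : eval c (resultant d) = 0 := by
  unfold resultant
  split_ifs with h
  · have := Submodule.IsPrincipal.generator_mem (S := vanishingIdeal ℂ (solvableSystems d))
    simpa [aeval_eq_eval] using mem_vanishingIdeal_iff.1 this c hc
  · simp

lemma eval_coeffIn (S : Finset (Fin n)) (b : Fin n → ℕ) (p : Poly n) (x : Fin n → ℂ) :
    eval x (coeffIn S b p) =
      ∑ m ∈ p.support with ∀ i ∈ S, m i = b i, p.coeff m * ∏ i ∈ Sᶜ, x i ^ m i := by
  rw [coeffIn, map_sum]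
  refine Finset.sum_congr rfl fun m _ => ?_
  rw [eval_monomial]
  congr 1
  rw [Finsupp.prod_fintype _ _ (by simp), ← Finset.prod_subset (Finset.subset_univ Sᶜ)]
  · refine Finset.prod_congr rfl fun i hi => ?_
    rw [Finsupp.filter_apply_pos _ _ (by simpa using hi)]
  · intro i _ hi
    rw [Finsupp.filter_apply_neg _ _ (by simpa using hi), pow_zero]

/-- Dehomogenization: the form obtained from `p` by homogenizing in degree `D` with respect to the
variables `x_S` takes at the point `(1, x_S)` the same value as `p`. -/
lemma sum_eval_coeffIn (S : Finset (Fin n)) (p : Poly n) (D : ℕ) (hD : degreeIn S p ≤ D)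
    (x : Fin n → ℂ) :
    ∑ a : {a : Option S →₀ ℕ // a ∈ (Finset.univ : Finset (Option S)).finsuppAntidiag D},
      eval x (coeffIn S (fun i => if h : i ∈ S then a.1 (some ⟨i, h⟩) else 0) p) *
        ∏ j : Option S, (j.elim 1 fun i => x i) ^ a.1 j = eval x p := by
  classical
  simp_rw [eval_coeffIn, Finset.sum_filter, Finset.sum_mul]
  rw [Finset.sum_comm, eval_eq']
  refine Finset.sum_congr rfl fun m hm => ?_
  have hmD : ∑ i ∈ S, m i ≤ D := le_trans (Finset.le_sup (f := fun m => ∑ i ∈ S, m i) hm) hD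
  have hsum : ∑ i : S, m i = ∑ i ∈ S, m i := Finset.sum_coe_sort S fun i => m i
  -- the only exponent that contributes is that of the homogenization of the monomial `m`
  let a₀ : Option S →₀ ℕ :=
    Finsupp.equivFunOnFinite.symm fun o => o.elim (D - ∑ i ∈ S, m i) fun i => m i
  have ha₀ : a₀ ∈ (Finset.univ : Finset (Option S)).finsuppAntidiag D := by
    rw [Finset.mem_finsuppAntidiag]
    refine ⟨?_, Finset.subset_univ _⟩
    rw [Fintype.sum_option]
    simp only [a₀, Finsupp.equivFunOnFinite_symm_apply_apply, Option.elim, hsum]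
    omega
  rw [Finset.sum_eq_single ⟨a₀, ha₀⟩]
  · rw [if_pos]
    · rw [Fintype.prod_option, ← Finset.prod_mul_prod_compl S fun i => x i ^ m i,
        ← Finset.prod_coe_sort S fun i => x i ^ m i]
      simp [a₀]
      ring
    · intro i hi
      simp [a₀, hi]
  · intro a _ hne
    rw [if_neg, zero_mul]
    intro h
    apply hne
    have h1 : ∀ i : S, a.1 (some i) = m i := fun i => by
      have := h i.1 i.2
      simpa using this.symm
    have h2 := (Finset.mem_finsuppAntidiag.1 a.2).1
    rw [Fintype.sum_option] at h2
    simp only [h1, hsum] at h2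
    ext o
    cases o with
    | none =>
      simp only [a₀, Finsupp.equivFunOnFinite_symm_apply_apply, Option.elim]
      omega
    | some i => simp [a₀, h1]
  · simp

/-- The value of a polynomial in the perturbation variable over `ℂ[x]` at the point `(s, x)`. -/
abbrev evalAt (s : ℂ) (x : Fin n → ℂ) : Polynomial (Poly n) →+* ℂ :=
  Polynomial.eval₂RingHom (eval x) s

/-- The equations, in the chart `x₀ = 1`, of the perturbed system. -/
def perturbedEq (S : Finset (Fin n)) (F : Option S → Poly n) (o : Option S) :
    Polynomial (Poly n) :=
  Polynomial.C (F o) -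
    Polynomial.X * Polynomial.C ((o.elim 1 fun i => X i.1) ^ formDegree S (F o))

/-- The resultant of the perturbed system, a polynomial in the perturbation variable. -/
def perturbedRes (S : Finset (Fin n)) (F : Option S → Poly n) : Polynomial (Poly n) :=
  MvPolynomial.eval₂ (Polynomial.C.comp MvPolynomial.C) (perturbedCoeff S F)
    (resultant (fun o => formDegree S (F o)))

lemma PRes_eq (S : Finset (Fin n)) (F : Option S → Poly n) :
    PRes S F = (perturbedRes S F).trailingCoeff := rfl

lemma evalAt_perturbedEq (S : Finset (Fin n)) (F : Option S → Poly n) (s : ℂ) (x : Fin n → ℂ)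
    (o : Option S) : evalAt s x (perturbedEq S F o) =
      eval x (F o) - s * (o.elim 1 fun i => x i) ^ formDegree S (F o) := by
  have h : eval x (o.elim 1 fun i => X i.1) = o.elim 1 fun i => x i := by cases o <;> simp
  rw [perturbedEq, map_sub, map_mul, ← h, ← map_pow]
  simp only [Polynomial.coe_eval₂RingHom, Polynomial.eval₂_C, Polynomial.eval₂_X]

lemma sum_single_mul_prod {ι : Type} [Fintype ι] [DecidableEq ι] (o : ι) (D : ℕ) (s : ℂ)
    (y : ι → ℂ) :
    ∑ a : {a : ι →₀ ℕ // a ∈ (Finset.univ : Finset ι).finsuppAntidiag D},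
      (if a.1 = Finsupp.single o D then s else 0) * ∏ j, y j ^ a.1 j = s * y o ^ D := by
  have hmem : Finsupp.single o D ∈ (Finset.univ : Finset ι).finsuppAntidiag D := by
    rw [Finset.mem_finsuppAntidiag]
    exact ⟨by simp [Finsupp.single_apply], Finset.subset_univ _⟩
  rw [Finset.sum_eq_single ⟨_, hmem⟩]
  · rw [if_pos rfl, Finset.prod_eq_single o]
    · simp
    · intro j _ hj
      rw [Finsupp.single_apply, if_neg (Ne.symm hj), pow_zero]
    · simp
  · intro a _ ha
    rw [if_neg fun h => ha (Subtype.ext h), zero_mul]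
  · simp

lemma evalAt_perturbedCoeff (S : Finset (Fin n)) (F : Option S → Poly n) (s : ℂ) (x : Fin n → ℂ)
    (t : CoeffIndex (fun o => formDegree S (F o))) : evalAt s x (perturbedCoeff S F t) =
      eval x (coeffIn S (fun i => if h : i ∈ S then t.2.1 (some ⟨i, h⟩) else 0) (F t.1)) -
        if t.2.1 = Finsupp.single t.1 (formDegree S (F t.1)) then s else 0 := by
  rw [perturbedCoeff, map_sub, Polynomial.coe_eval₂RingHom, Polynomial.eval₂_C, apply_ite
    (Polynomial.eval₂ (eval x) s), Polynomial.eval₂_X, Polynomial.eval₂_zero]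

/-- A zero `(s, x)` of the perturbed system yields the nontrivial common zero `(1, x_S)` of the
perturbed forms, so that their resultant vanishes there. -/
lemma evalAt_perturbedRes (S : Finset (Fin n)) (F : Option S → Poly n) (s : ℂ) (x : Fin n → ℂ)
    (h : ∀ o, evalAt s x (perturbedEq S F o) = 0) : evalAt s x (perturbedRes S F) = 0 := by
  have h1 : evalAt s x (perturbedRes S F) =
      eval (fun t => evalAt s x (perturbedCoeff S F t))
        (resultant fun o => formDegree S (F o)) := by
    rw [perturbedRes, ← MvPolynomial.coe_eval₂Hom, ← RingHom.comp_apply, eval]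
    congr 1
    ext t <;> simp
  rw [h1]
  apply resultant_eval_eq_zero
  refine ⟨fun o => o.elim 1 fun i => x i, fun h => by simpa using congrFun h none, fun o => ?_⟩
  have h2 := h o
  have h3 := sum_single_mul_prod o (formDegree S (F o)) s fun o => o.elim 1 fun i => x i
  beta_reduce at h3
  rw [evalAt_perturbedEq, ← sum_eval_coeffIn S (F o) (formDegree S (F o)) (le_max_right _ _) x,
    ← h3, ← Finset.sum_sub_distrib] at h2
  rw [← h2]
  refine Finset.sum_congr rfl fun a _ => ?_
  beta_reduce
  rw [evalAt_perturbedCoeff, ← sub_mul]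

/-- The Nullstellensatz in `ℂ[x][s]`, transported from polynomials in `n + 1` variables. -/
lemma mem_radical_of_evalAt (I : Ideal (Polynomial (Poly n))) (R : Polynomial (Poly n))
    (h : ∀ s x, (∀ E ∈ I, evalAt s x E = 0) → evalAt s x R = 0) : R ∈ I.radical := by
  let e := optionEquivLeft ℂ (Fin n)
  have he : ∀ (y : Option (Fin n) → ℂ) q,
      aeval y q = evalAt (y none) (fun i => y (some i)) (e q) := by
    intro y q
    have : (aeval y : MvPolynomial (Option (Fin n)) ℂ →ₐ[ℂ] ℂ).toRingHom =
        (evalAt (y none) fun i => y (some i)).comp (e : MvPolynomial (Option (Fin n)) ℂ →+* _) := by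
      ext i
      · simp [e]
      · cases i <;> simp [e, optionEquivLeft_X_none, optionEquivLeft_X_some]
    exact congrArg (fun f => f q) this
  have h1 : e.symm R ∈ (I.comap (e : MvPolynomial (Option (Fin n)) ℂ →+* _)).radical := by
    rw [← vanishingIdeal_zeroLocus_eq_radical (K := ℂ), mem_vanishingIdeal_iff]
    intro y hy
    rw [he, AlgEquiv.apply_symm_apply]
    refine h _ _ fun E hE => ?_
    have := hy (e.symm E) (by simpa [Ideal.mem_comap] using hE)
    rwa [he, AlgEquiv.apply_symm_apply] at this
  obtain ⟨k, hk⟩ := h1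
  refine ⟨k, ?_⟩
  simpa [Ideal.mem_comap] using hk

/-- The decisive property of the generalized resultant: it vanishes on an irreducible subset
`Z(P₀)` of the zero set of the system `F`, provided that no larger irreducible set of zeros has
dimension exceeding that expected from the number of equations.

A component through `{0} × Z(P₀)` of the zero set of the perturbed system has at least the expected
dimension, one more than that of the unperturbed system, and hence does not lie in the hyperplane
`s = 0`. On this component the resultant vanishes even after the highest possible power of `s` is
cancelled, and the value at `s = 0` of what remains is the generalized resultant. -/
theorem PRes_mem (S : Finset (Fin n)) (F : Option S → Poly n) (P₀ : Ideal (Poly n))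
    [hP₀ : P₀.IsPrime] (hF : ∀ o, F o ∈ P₀)
    (hdim : ∀ Q : Ideal (Poly n), Q.IsPrime → Q ≤ P₀ → (∀ o, F o ∈ Q) → quotDim Q + S.card < n) :
    PRes S F ∈ P₀ := by
  let ev : Polynomial (Poly n) →+* Poly n := Polynomial.evalRingHom 0
  have hprime : (P₀.comap ev).IsPrime := Ideal.comap_isPrime _ _
  have hle : Ideal.span (Set.range (perturbedEq S F)) ≤ P₀.comap ev := by
    rw [Ideal.span_le]
    rintro _ ⟨o, rfl⟩
    simp [ev, perturbedEq, hF]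
  obtain ⟨P, hP, hPle⟩ := Ideal.exists_minimalPrimes_le hle
  have hPprime := hP.isPrime
  have hEP : ∀ o, perturbedEq S F o ∈ P := fun o => hP.le (Ideal.subset_span ⟨o, rfl⟩)
  have hX : Polynomial.X ∉ P := by
    intro hX
    have h1 := card_le_ncard_add_quotDim (optionEquivLeft ℂ (Fin n))
      (Set.finite_range (perturbedEq S F)) hP
    have h2 : (Set.range (perturbedEq S F)).ncard ≤ S.card + 1 := by
      rw [← Set.image_univ]
      refine (Set.ncard_image_le Set.finite_univ).trans ?_
      rw [Set.ncard_univ, Nat.card_eq_fintype_card, Fintype.card_option, Fintype.card_coe]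
    rw [Fintype.card_option, Fintype.card_fin] at h1
    let Cₐ : Poly n →ₐ[ℂ] Polynomial (Poly n) := IsScalarTower.toAlgHom ℂ _ _
    have h3 : quotDim P ≤ quotDim (P.comap Cₐ) := by
      refine quotDim_le_of_surjective (Ideal.quotientMapₐ P Cₐ le_rfl) fun y => ?_
      obtain ⟨y, rfl⟩ := Ideal.Quotient.mk_surjective y
      refine ⟨Ideal.Quotient.mk _ (y.coeff 0), ?_⟩
      change Ideal.Quotient.mk P (Polynomial.C (y.coeff 0)) = Ideal.Quotient.mk P y
      rw [eq_comm, Ideal.Quotient.eq]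
      rw [sub_eq_of_eq_add (Polynomial.X_mul_divX_add y).symm]
      exact P.mul_mem_right _ hX
    have h4 := hdim (P.comap Cₐ) (Ideal.comap_isPrime _ _)
      (fun q hq => by simpa [ev, Cₐ] using hPle hq) fun o => by
        have := P.add_mem (hEP o) (P.mul_mem_right
          (Polynomial.C ((o.elim 1 fun i => X i.1) ^ formDegree S (F o))) hX)
        rw [perturbedEq, sub_add_cancel] at this
        exact this
    omega
  have hR : perturbedRes S F ∈ P := by
    refine (hPprime.radical_le_iff.2 hP.le) (mem_radical_of_evalAt _ _ fun s x h => ?_)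
    exact evalAt_perturbedRes S F s x fun o => h _ (Ideal.subset_span ⟨o, rfl⟩)
  obtain ⟨R, hR'⟩ : Polynomial.X ^ (perturbedRes S F).natTrailingDegree ∣ perturbedRes S F :=
    Polynomial.X_pow_dvd_iff.2 fun k hk => Polynomial.coeff_eq_zero_of_lt_natTrailingDegree hk
  have h0 : PRes S F = R.coeff 0 := by
    have := Polynomial.coeff_X_pow_mul R (perturbedRes S F).natTrailingDegree 0
    rwa [zero_add, ← hR'] at this
  rw [hR'] at hR
  have hRP : R ∈ P := (hPprime.mem_or_mem hR).resolve_left fun h => hX (hPprime.mem_of_pow_mem _ h)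
  have := hPle hRP
  rw [h0, Polynomial.coeff_zero_eq_eval_zero]
  exact this

/-- The substitution of zero for the variables `x_S`. -/
def killVars (S : Finset (Fin n)) : Poly n →ₐ[ℂ] Poly n :=
  aeval fun i => if i ∈ S then 0 else X i

lemma killVars_coeffIn (S : Finset (Fin n)) (b : Fin n → ℕ) (p : Poly n) :
    killVars S (coeffIn S b p) = coeffIn S b p := by
  rw [coeffIn, map_sum]
  refine Finset.sum_congr rfl fun m _ => ?_
  rw [killVars, aeval_monomial, monomial_eq]
  congr 1
  refine Finsupp.prod_congr fun i hi => ?_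
  rw [Finsupp.support_filter, Finset.mem_filter] at hi
  rw [if_neg hi.2]

lemma vars_PRes_subset (S : Finset (Fin n)) (F : Option S → Poly n) : (PRes S F).vars ⊆ Sᶜ := by
  have h1 : Polynomial.mapRingHom (killVars S : Poly n →+* Poly n) (perturbedRes S F) =
      perturbedRes S F := by
    rw [perturbedRes, ← MvPolynomial.coe_eval₂Hom, ← RingHom.comp_apply]
    congr 1
    ext t : 2
    · simp
    · simp only [RingHom.comp_apply, eval₂Hom_X', perturbedCoeff, map_sub]
      split_ifs <;> simp [killVars_coeffIn]
  have h2 : killVars S (PRes S F) = PRes S F := by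
    have := congrArg (fun q => q.coeff (perturbedRes S F).natTrailingDegree) h1
    simpa [PRes_eq, Polynomial.trailingCoeff] using this
  rw [← h2]
  intro i hi
  obtain ⟨j, -, hj⟩ := mem_vars_bind₁ _ _ hi
  split_ifs at hj with h
  · simp at hj
  · rw [vars_X, Finset.mem_singleton] at hj
    simpa [hj] using h

end GeneralizedResultant

/-! ### Greedy bases of matroids on an ordered set -/

section Greedy

variable {n : ℕ}

/-- An independent set `B` of a matroid on `{1, …, n}` which is the outcome of the greedy
procedure that runs through the elements in decreasing order: every element outside `B` is spanned
by the larger elements of `B`. -/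
def IsGreedy (M : Matroid (Fin n)) (B : Finset (Fin n)) : Prop :=
  M.Indep (B : Set (Fin n)) ∧ ∀ i ∉ B, i ∈ M.closure ((B : Set (Fin n)) ∩ Set.Ioi i)

variable {M : Matroid (Fin n)} {B B' : Finset (Fin n)}

lemma IsGreedy.mem_closure (hB : IsGreedy M B) (hE : M.E = Set.univ) (i : Fin n) :
    i ∈ M.closure ((B : Set (Fin n)) ∩ Set.Ici i) := by
  by_cases h : i ∈ B
  · exact M.mem_closure_of_mem ⟨h, Set.mem_Ici.2 le_rfl⟩ (by simp [hE])
  · exact M.closure_subset_closure (Set.inter_subset_inter_right _ Set.Ioi_subset_Ici_self)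
      (hB.2 i h)

lemma IsGreedy.Ioi_subset_closure (hB : IsGreedy M B) (hE : M.E = Set.univ) (i : Fin n) :
    Set.Ioi i ⊆ M.closure ((B : Set (Fin n)) ∩ Set.Ioi i) := fun l hl =>
  M.closure_subset_closure (Set.inter_subset_inter_right _ fun _ hk =>
    lt_of_lt_of_le (Set.mem_Ioi.1 hl) (Set.mem_Ici.1 hk)) (hB.mem_closure hE l)

lemma exists_isGreedy (M : Matroid (Fin n)) (hE : M.E = Set.univ) : ∃ B, IsGreedy M B := by
  classical
  let B : Finset (Fin n) := {i | i ∉ M.closure (Set.Ioi i)}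
  have hB : ∀ i, i ∈ B ↔ i ∉ M.closure (Set.Ioi i) := fun i => by simp [B]
  have hcl : ∀ l, l ∈ M.closure ((B : Set (Fin n)) ∩ Set.Ici l) ∧
      (l ∉ B → l ∈ M.closure ((B : Set (Fin n)) ∩ Set.Ioi l)) := by
    intro l
    induction l using WellFoundedGT.induction with
    | ind l ih =>
      have h1 : l ∉ B → l ∈ M.closure ((B : Set (Fin n)) ∩ Set.Ioi l) := by
        intro h
        rw [hB, not_not] at h
        refine M.closure_subset_closure_of_subset_closure (fun k hk => ?_) h
        exact M.closure_subset_closure (Set.inter_subset_inter_right _ fun _ hj =>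
          lt_of_lt_of_le (Set.mem_Ioi.1 hk) (Set.mem_Ici.1 hj)) (ih k hk).1
      refine ⟨?_, h1⟩
      by_cases h : l ∈ B
      · exact M.mem_closure_of_mem ⟨h, Set.mem_Ici.2 le_rfl⟩ (by simp [hE])
      · exact M.closure_subset_closure (Set.inter_subset_inter_right _ Set.Ioi_subset_Ici_self)
          (h1 h)
  refine ⟨B, ?_, fun i hi => (hcl i).2 hi⟩
  have : ∀ s : Finset (Fin n), s ⊆ B → M.Indep (s : Set (Fin n)) := by
    intro s
    induction s using Finset.induction_on_min with
    | empty => simp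
    | insert a s ha ih =>
      intro hs
      rw [Finset.insert_subset_iff] at hs
      rw [Finset.coe_insert, (ih hs.2).insert_indep_iff]
      refine Or.inl ⟨by simp [hE], fun h => (hB a).1 hs.1 ?_⟩
      exact M.closure_subset_closure (fun x hx => ha x hx) h
  exact this B subset_rfl

lemma IsGreedy.eq (hB : IsGreedy M B) (hB' : IsGreedy M B') : B = B' := by
  by_contra hne
  -- the largest element in which two greedy sets differ is spanned by the larger ones
  obtain ⟨i, hi, hmax⟩ := (symmDiff B B').exists_max_image id (by
    rw [Finset.nonempty_iff_ne_empty]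
    exact fun h => hne (symmDiff_eq_bot.1 h))
  have key : ∀ A A' : Finset (Fin n), IsGreedy M A → IsGreedy M A' →
      (∀ l ∈ symmDiff A A', l ≤ i) → i ∈ A → i ∉ A' → False := by
    intro A A' hA hA' hm h1 h2
    refine (hA.1.notMem_closure_sdiff_of_mem h1) (M.closure_subset_closure ?_ (hA'.2 i h2))
    rintro l ⟨hl, hil⟩
    refine ⟨?_, fun h => (ne_of_gt hil) h⟩
    by_contra hlA
    exact absurd (hm l (Finset.mem_symmDiff.2 (Or.inr ⟨hl, hlA⟩))) (not_le_of_gt hil)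
  rcases Finset.mem_symmDiff.1 hi with h | h
  · exact key B B' hB hB' hmax h.1 h.2
  · exact key B' B hB' hB (fun l hl => hmax l (symmDiff_comm B B' ▸ hl)) h.1 h.2

lemma list_le_of_countP_le : ∀ (l l' : List (Fin n)), l.Pairwise (· < ·) → l'.Pairwise (· < ·) →
    l.length = l'.length → (∀ i, l.countP (fun x => i < x) ≤ l'.countP (fun x => i < x)) → l ≤ l'
  | [], [], _, _, _, _ => le_rfl
  | [], b :: l', _, _, h, _ => by simp at h
  | a :: l, [], _, _, h, _ => by simp at h
  | a :: l, b :: l', hl, hl', h, hc => by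
    rw [List.pairwise_cons] at hl hl'
    rw [List.length_cons, List.length_cons, Nat.succ_inj] at h
    rcases lt_trichotomy a b with hab | rfl | hab
    · exact le_of_lt (List.Lex.rel hab)
    · refine List.cons_le_cons a (list_le_of_countP_le l l' hl.2 hl'.2 h fun i => ?_)
      have := hc i
      rw [List.countP_cons, List.countP_cons] at this
      omega
    · exfalso
      have h1 := hc b
      rw [List.countP_cons_of_pos (by simpa using hab), List.countP_cons_of_neg (by simp),
        List.countP_eq_length.2 fun x hx => by simpa using hab.trans (hl.1 x hx)] at h1
      have := List.countP_le_length (p := fun x => decide (b < x)) (l := l')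
      omega

lemma countP_sort (A : Finset (Fin n)) (i : Fin n) :
    (A.sort (· ≤ ·)).countP (fun x => i < x) = (A.filter (i < ·)).card := by
  rw [← Multiset.coe_countP, Finset.sort_eq, Multiset.countP_eq_card_filter]
  rfl

/-- The greedy basis dominates all other bases: it has at least as many elements above any given
threshold. -/
lemma IsGreedy.sort_le (hB : IsGreedy M B) (hE : M.E = Set.univ) {A : Finset (Fin n)}
    (hA : M.Indep (A : Set (Fin n))) (hcard : A.card = B.card) :
    A.sort (· ≤ ·) ≤ B.sort (· ≤ ·) := by
  refine list_le_of_countP_le _ _ A.sortedLT_sort.pairwise B.sortedLT_sort.pairwise (by simpa)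
    fun i => ?_
  rw [countP_sort, countP_sort]
  have hcoe : ∀ D : Finset (Fin n), ((D.filter (i < ·) : Finset (Fin n)) : Set (Fin n)) =
      (D : Set (Fin n)) ∩ Set.Ioi i := fun D => by ext; simp
  have h1 : M.Indep ((A : Set (Fin n)) ∩ Set.Ioi i) := hA.subset Set.inter_subset_left
  have h2 : M.Indep ((B : Set (Fin n)) ∩ Set.Ioi i) := hB.1.subset Set.inter_subset_left
  have h3 := h1.encard_le_eRk_of_subset
    (Set.inter_subset_right.trans (hB.Ioi_subset_closure hE i))
  rw [M.eRk_closure_eq, h2.eRk_eq_encard, ← hcoe, ← hcoe, Set.encard_coe_eq_coe_finsetCard,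
    Set.encard_coe_eq_coe_finsetCard] at h3
  exact_mod_cast h3

end Greedy

/-! ### Transcendence bases consisting of variables -/

section TranscendenceBases

variable {n : ℕ}

/-- The coordinates of the generic point of a variety, in its coordinate ring. -/
def coord (P : Ideal (Poly n)) (i : Fin n) : Poly n ⧸ P := Ideal.Quotient.mk P (X i)

lemma aeval_coord (P : Ideal (Poly n)) (p : Poly n) :
    aeval (coord P) p = Ideal.Quotient.mk P p := by
  have : aeval (coord P) = Ideal.Quotient.mkₐ ℂ P := by ext i; simp [coord]
  rw [this]; rfl

/-- The algebraic matroid of the variables modulo a prime ideal. -/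
def coordMatroid (P : Ideal (Poly n)) [P.IsPrime] : Matroid (Fin n) :=
  (AlgebraicIndependent.matroid ℂ (Poly n ⧸ P)).comap (coord P)

variable (P : Ideal (Poly n)) [hP : P.IsPrime]

lemma coordMatroid_ground : (coordMatroid P).E = Set.univ := rfl

lemma coordMatroid_indep_iff {s : Set (Fin n)} :
    (coordMatroid P).Indep s ↔ AlgebraicIndepOn ℂ (coord P) s := by
  rw [coordMatroid, Matroid.comap_indep_iff]
  constructor
  · rintro ⟨h, hinj⟩
    exact (algebraicIndependent_image hinj).2 (AlgebraicIndependent.matroid_indep_iff.1 h)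
  · intro h
    have hinj : Set.InjOn (coord P) s := Set.injOn_iff_injective.2 h.injective
    exact ⟨AlgebraicIndependent.matroid_indep_iff.2 ((algebraicIndependent_image hinj).1 h), hinj⟩

lemma mem_coordMatroid_closure_iff {s : Set (Fin n)} {i : Fin n} :
    i ∈ (coordMatroid P).closure s ↔
      IsAlgebraic (Algebra.adjoin ℂ (coord P '' s)) (coord P i) := by
  rw [coordMatroid, Matroid.comap_closure_eq, Set.mem_preimage,
    AlgebraicIndependent.matroid_closure_eq]
  rfl

lemma isAlgebraic_of_coord {s : Set (Fin n)}
    (h : ∀ i, IsAlgebraic (Algebra.adjoin ℂ (coord P '' s)) (coord P i)) :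
    Algebra.IsAlgebraic (Algebra.adjoin ℂ (coord P '' s)) (Poly n ⧸ P) := by
  refine ⟨fun y => ?_⟩
  obtain ⟨p, rfl⟩ := Ideal.Quotient.mk_surjective y
  rw [← aeval_coord]
  have h1 : ∀ i, coord P i ∈
      (Subalgebra.algebraicClosure (Algebra.adjoin ℂ (coord P '' s)) (Poly n ⧸ P)).restrictScalars
        ℂ := h
  have h2 : aeval (coord P) p ∈
      (Subalgebra.algebraicClosure (Algebra.adjoin ℂ (coord P '' s)) (Poly n ⧸ P)).restrictScalars
        ℂ := by
    refine (Algebra.adjoin_le (Set.range_subset_iff.2 h1)) ?_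
    rw [Algebra.adjoin_range_eq_range_aeval]
    exact ⟨p, rfl⟩
  exact h2

lemma IsGreedy.isTranscendenceBasis {B : Finset (Fin n)} (hB : IsGreedy (coordMatroid P) B) :
    IsTranscendenceBasis ℂ (fun b : B => coord P b.1) := by
  have hind := (coordMatroid_indep_iff P).1 hB.1
  refine (AlgebraicIndependent.isTranscendenceBasis_iff_isAlgebraic hind).2 ?_
  rw [← Set.image_eq_range]
  refine isAlgebraic_of_coord P fun i => ?_
  rw [← mem_coordMatroid_closure_iff]
  exact Matroid.closure_subset_closure _ Set.inter_subset_left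
    (hB.mem_closure (coordMatroid_ground P) i)

lemma card_eq_quotDim {B : Finset (Fin n)}
    (hB : IsTranscendenceBasis ℂ (fun b : B => coord P b.1)) : B.card = quotDim P := by
  rw [quotDim, ← hB.cardinalMk_eq_trdeg]
  simp

lemma isLexMaxTransBasis_of_isGreedy {C : Set (Fin n → ℂ)} [(idealOf C).IsPrime]
    {B : Finset (Fin n)} (hB : IsGreedy (coordMatroid (idealOf C)) B) : IsLexMaxTransBasis C B := by
  refine ⟨hB.isTranscendenceBasis, fun B' hB' => ?_⟩
  refine hB.sort_le (coordMatroid_ground _) ((coordMatroid_indep_iff _).2 hB'.1) ?_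
  rw [card_eq_quotDim _ hB', card_eq_quotDim _ hB.isTranscendenceBasis]

end TranscendenceBases

/-! ### Passage to the field of rational functions in the free variables -/

section GenericFibre

variable {n : ℕ}

/-- A prime ideal `P` of `ℂ[x]` modulo which the variables outside `S` are algebraically
independent is the contraction of a prime ideal of `ℂ(x_{Sᶜ})[x_S]`, the kernel of the evaluation
at the generic point of `Z(P)`. -/
lemma exists_isPrime_toFrac (P : Ideal (Poly n)) [P.IsPrime] (S : Finset (Fin n))
    (hS : AlgebraicIndependent ℂ (fun i : {i : Fin n // i ∉ S} => coord P i)) :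
    ∃ K : Ideal (MvPolynomial {i : Fin n // i ∈ S} (FracField S)), K.IsPrime ∧
      ∀ q, toFrac S q ∈ K ↔ q ∈ P := by
  let L := FractionRing (Poly n ⧸ P)
  have hinjL : Function.Injective (algebraMap (Poly n ⧸ P) L) := IsFractionRing.injective _ _
  let base : MvPolynomial {i : Fin n // i ∉ S} ℂ →+* L :=
    (algebraMap (Poly n ⧸ P) L).comp
      (aeval (fun i : {i : Fin n // i ∉ S} => coord P i) : _ →ₐ[ℂ] _).toRingHom
  have hbase : Function.Injective base := hinjL.comp hS
  let ψ : MvPolynomial {i : Fin n // i ∈ S} (FracField S) →+* L :=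
    eval₂Hom (IsFractionRing.lift hbase) fun i => algebraMap _ L (coord P i)
  have hψ : ψ.comp (toFrac S) = (algebraMap (Poly n ⧸ P) L).comp (Ideal.Quotient.mk P) := by
    ext i
    · simp only [toFrac, ψ, base, RingHom.comp_apply, eval₂Hom_C, IsFractionRing.lift_algebraMap]
      simp
      rfl
    · by_cases h : i ∈ S
      · simp [toFrac, ψ, h, coord]
      · simp only [toFrac, ψ, base, RingHom.comp_apply, eval₂Hom_X', h, dif_neg, not_false_iff,
          eval₂Hom_C, IsFractionRing.lift_algebraMap]
        simp [coord]
  refine ⟨RingHom.ker ψ, RingHom.ker_isPrime _, fun q => ?_⟩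
  have := congrArg (fun f => f q) hψ
  simp only [RingHom.comp_apply] at this
  rw [RingHom.mem_ker, this, map_eq_zero_iff _ hinjL, Ideal.Quotient.eq_zero_iff_mem]

end GenericFibre

/-! ### The input condition of the zero-dimensional decomposition -/

section ZeroDim

variable {n : ℕ}

/-- A polynomial which involves at most one of the variables `x_S`, seen as a univariate polynomial
over `ℂ(x_{Sᶜ})`. -/
lemma exists_toFrac_eq_aeval (S : Finset (Fin n)) {i : Fin n} (hi : i ∈ S) (p : Poly n)
    (hp : ∀ j ∈ p.vars, j = i ∨ j ∉ S) :
    ∃ u : Polynomial (FracField S), toFrac S p = Polynomial.aeval (X ⟨i, hi⟩) u := by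
  let τ : Poly n →+* Polynomial (FracField S) := eval₂Hom
    ((Polynomial.C.comp (algebraMap (MvPolynomial {i : Fin n // i ∉ S} ℂ) (FracField S))).comp C)
    (fun j => if h : j ∈ S then Polynomial.X else
      Polynomial.C (algebraMap (MvPolynomial {i : Fin n // i ∉ S} ℂ) (FracField S) (X ⟨j, h⟩)))
  refine ⟨τ p, ?_⟩
  let ρ : Polynomial (FracField S) →ₐ[FracField S]
      MvPolynomial {i : Fin n // i ∈ S} (FracField S) :=
    Polynomial.aeval (X ⟨i, hi⟩)
  change toFrac S p = ((ρ : _ →+* _).comp τ) p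
  refine hom_congr_vars ?_ ?_ rfl
  · ext c
    simp [toFrac, τ, ρ, MvPolynomial.algebraMap_eq]
  · intro j hj _
    by_cases h : j ∈ S
    · obtain rfl : j = i := (hp j hj).resolve_right (not_not.2 h)
      simp [toFrac, τ, ρ, h]
    · simp [toFrac, τ, ρ, h, MvPolynomial.algebraMap_eq]

lemma squarefree_of_squarefree_aeval {K ι : Type} [Field K] (i : ι) {u : Polynomial K}
    (hu : Squarefree (Polynomial.aeval (X i : MvPolynomial ι K) u)) : Squarefree u := by
  intro v hv
  have h1 : IsUnit (Polynomial.aeval (X i : MvPolynomial ι K) v) :=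
    hu _ (by rw [← map_mul]; exact map_dvd _ hv)
  have h2 : (aeval fun _ => Polynomial.X : MvPolynomial ι K →ₐ[K] Polynomial K)
      (Polynomial.aeval (X i) v) = v := by
    rw [← AlgHom.comp_apply]
    conv_rhs => rw [← AlgHom.id_apply (R := K) v]
    congr 1
    ext
    simp
  rw [← h2]
  exact h1.map _

/-- An ideal that contains a nonzero polynomial in each single variable is zero-dimensional. -/
lemma finite_quotient {K ι : Type} [Field K] [Finite ι] (I : Ideal (MvPolynomial ι K))
    (u : ι → Polynomial K) (hu : ∀ i, u i ≠ 0) (hmem : ∀ i, Polynomial.aeval (X i) (u i) ∈ I) :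
    Module.Finite K (MvPolynomial ι K ⧸ I) := by
  have hint : ∀ i, Ideal.Quotient.mkₐ K I (X i) ∈ integralClosure K (MvPolynomial ι K ⧸ I) :=
    fun i => by
      refine IsAlgebraic.isIntegral ⟨u i, hu i, ?_⟩
      rw [Polynomial.aeval_algHom_apply]
      exact Ideal.Quotient.eq_zero_iff_mem.2 (hmem i)
  have : Algebra.IsIntegral K (MvPolynomial ι K ⧸ I) := by
    refine ⟨fun y => ?_⟩
    obtain ⟨p, rfl⟩ := Ideal.Quotient.mk_surjective y
    refine Algebra.adjoin_le (Set.range_subset_iff.2 hint) ?_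
    rw [Algebra.adjoin_range_eq_range_aeval]
    refine ⟨p, ?_⟩
    change (aeval fun i => Ideal.Quotient.mkₐ K I (X i)) p = _
    rw [← MvPolynomial.comp_aeval_apply, aeval_X_left]
    rfl
  exact Algebra.IsIntegral.finite

/-- The input condition holds as soon as each `h_i` is, over `ℂ(x_{Sᶜ})`, a squarefree univariate
polynomial in `x_i`: the ideal contains a nonzero polynomial in each single variable, and the
Jacobian matrix is diagonal with nonzero entries, since squarefree polynomials are separable in
characteristic zero. -/
lemma triangularZeroDimInput (S : Finset (Fin n)) (h : Fin n → Poly n) (T : Set (Poly n))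
    (hvars : ∀ i ∈ S, ∀ j ∈ (h i).vars, j = i ∨ j ∉ S)
    (hsq : ∀ i ∈ S, Squarefree (toFrac S (h i))) : TriangularZeroDimInput S h T := by
  choose u hu using fun i : {i : Fin n // i ∈ S} =>
    exists_toFrac_eq_aeval S i.2 (h i) (hvars i i.2)
  have hmem : ∀ i, Polynomial.aeval (X i) (u i) ∈ fracIdeal S h T := fun i => by
    rw [← hu i]
    exact Ideal.subset_span ⟨h i, Or.inl ⟨i, i.2, rfl⟩, rfl⟩
  have husq : ∀ i, Squarefree (u i) := fun i =>
    squarefree_of_squarefree_aeval i (by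
      have := hsq i i.2
      rwa [hu i] at this)
  have hCZ : CharZero (FracField S) :=
    charZero_of_injective_algebraMap (algebraMap ℂ (FracField S)).injective
  refine ⟨?_, fun x hx => ?_⟩
  · exact finite_quotient _ u (fun i => (husq i).ne_zero) hmem
  · have hdiag : (Matrix.of (fun i j : {i : Fin n // i ∈ S} =>
        aeval x (pderiv j (toFrac S (h i))))) =
        Matrix.diagonal fun i => Polynomial.aeval (x i) (Polynomial.derivative (u i)) := by
      ext i j
      rw [Matrix.of_apply, hu i, Derivation.map_aeval, Matrix.diagonal_apply]
      split_ifs with hij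
      · subst hij
        rw [pderiv_X_self, smul_eq_mul, mul_one, ← Polynomial.aeval_algHom_apply, aeval_X]
      · rw [pderiv_X_of_ne hij, smul_zero, map_zero]
    rw [hdiag, Matrix.isUnit_iff_isUnit_det, Matrix.det_diagonal, isUnit_iff_ne_zero,
      Finset.prod_ne_zero_iff]
    intro i _
    refine (PerfectField.separable_iff_squarefree.2 (husq i)).aeval_derivative_ne_zero ?_
    have := hx _ (hmem i)
    rwa [← Polynomial.aeval_algHom_apply, aeval_X] at this

end ZeroDim

/-! ### Triangular sets -/

section Triangular

variable {n : ℕ}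

/-- The substitution of the elements `w_i` for all variables but `x_j`. -/
def substExcept {B : Type} [CommRing B] [Algebra ℂ B] (w : Fin n → B) (j : Fin n) :
    Poly n →ₐ[ℂ] Polynomial B :=
  aeval (Function.update (fun i => Polynomial.C (w i)) j Polynomial.X)

lemma coeff_substExcept {B : Type} [CommRing B] [Algebra ℂ B] (w : Fin n → B) (j : Fin n)
    (p : Poly n) (e : ℕ) :
    (substExcept w j p).coeff e = aeval w (coeffIn {j} (fun _ => e) p) := by
  conv_lhs => rw [p.as_sum]
  rw [coeffIn, map_sum, map_sum, Polynomial.finsetSum_coeff, Finset.sum_filter]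
  refine Finset.sum_congr rfl fun m _ => ?_
  have h1 : substExcept w j (monomial m (p.coeff m)) =
      Polynomial.C (algebraMap ℂ B (p.coeff m) * ∏ i ∈ Finset.univ.erase j, w i ^ m i) *
        Polynomial.X ^ m j := by
    rw [substExcept, aeval_monomial, Finsupp.prod_fintype _ _ (by simp),
      ← Finset.mul_prod_erase _ _ (Finset.mem_univ j), Function.update_self,
      Finset.prod_congr rfl fun i hi => by
        rw [Function.update_of_ne (Finset.ne_of_mem_erase hi)], map_mul, map_prod,
      IsScalarTower.algebraMap_apply ℂ B (Polynomial B)]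
    simp only [map_pow, Polynomial.algebraMap_eq]
    ring
  rw [h1, Polynomial.coeff_C_mul, Polynomial.coeff_X_pow]
  simp only [Finset.mem_singleton, forall_eq]
  split_ifs with h2 h3 h3
  · rw [mul_one, aeval_monomial, Finsupp.prod_fintype _ _ (by simp),
      ← Finset.mul_prod_erase _ _ (Finset.mem_univ j), Finsupp.filter_apply_neg _ _ (by simp),
      pow_zero, one_mul]
    congr 1
    refine Finset.prod_congr rfl fun i hi => ?_
    rw [Finsupp.filter_apply_pos _ _ (by simpa using Finset.ne_of_mem_erase hi)]
  · exact absurd h2.symm h3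
  · exact absurd h3.symm h2
  · simp

lemma vars_coeffIn_subset (S : Finset (Fin n)) (b : Fin n → ℕ) (p : Poly n) :
    (coeffIn S b p).vars ⊆ p.vars \ S := by
  classical
  refine (vars_sum_subset _ _).trans (Finset.biUnion_subset.2 fun m hm => ?_)
  rw [Finset.mem_filter] at hm
  rw [vars_monomial (mem_support_iff.1 hm.1), Finsupp.support_filter]
  intro i hi
  rw [Finset.mem_filter] at hi
  exact Finset.mem_sdiff.2 ⟨(mem_vars_iff_mem_support i).2 ⟨m, hm.1, hi.1⟩, hi.2⟩

variable (Δ : TriangularSet n)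

lemma TriangularSet.satIdeal_eq : Δ.satIdeal =
    saturation (Ideal.span (Set.range Δ.g)) (∏ k, Δ.lc k) := by
  have h1 : {p | ∃ j : Fin Δ.m, (j : ℕ) < Δ.m ∧ p = Δ.g j} = Set.range Δ.g := by
    ext p
    simp [eq_comm]
  have h2 : Finset.univ.filter (fun j : Fin Δ.m => (j : ℕ) < Δ.m) = Finset.univ := by
    ext; simp
  rw [TriangularSet.satIdeal, TriangularSet.satIdealUpTo, h1, h2]

lemma le_saturation {R : Type*} [CommRing R] (I : Ideal R) (h : R) : I ≤ saturation I h :=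
  fun p hp => ⟨0, by simpa using hp⟩

lemma notMem_of_mem_minimalPrimes_saturation {R : Type*} [CommRing R] {I P : Ideal R} {h : R}
    (hP : P ∈ (saturation I h).minimalPrimes) : h ∉ P := by
  intro hh
  obtain ⟨y, hy, N, hN⟩ := Ideal.exists_mul_mem_of_mem_minimalPrimes hP hh
  exact hy ⟨N + 1, by rwa [pow_succ, mul_assoc]⟩

lemma mem_minimalPrimes_of_saturation {R : Type*} [CommRing R] {I P : Ideal R} {h : R}
    (hP : P ∈ (saturation I h).minimalPrimes) : P ∈ I.minimalPrimes := by
  have hprime := hP.isPrime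
  refine ⟨⟨hprime, (le_saturation I h).trans hP.le⟩, fun Q ⟨hQ, hIQ⟩ hQP => ?_⟩
  refine hP.2 ⟨hQ, fun p ⟨N, hN⟩ => ?_⟩ hQP
  exact (hQ.mem_or_mem (hIQ hN)).resolve_left fun hh =>
    notMem_of_mem_minimalPrimes_saturation hP (hQP (hQ.mem_of_pow_mem _ hh))

variable {Δ} {P : Ideal (Poly n)}

lemma TriangularSet.lc_notMem (hP : P ∈ Δ.satIdeal.minimalPrimes) (k : Fin Δ.m) : Δ.lc k ∉ P := by
  rw [Δ.satIdeal_eq] at hP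
  exact fun h => notMem_of_mem_minimalPrimes_saturation hP
    (P.mem_of_dvd (Finset.dvd_prod_of_mem _ (Finset.mem_univ k)) h)

lemma TriangularSet.g_mem (hP : P ∈ Δ.satIdeal.minimalPrimes) (k : Fin Δ.m) : Δ.g k ∈ P := by
  rw [Δ.satIdeal_eq] at hP
  exact (mem_minimalPrimes_of_saturation hP).le (Ideal.subset_span ⟨k, rfl⟩)

/-- The leaders are algebraic over the free variables, since the initials do not vanish. -/
lemma TriangularSet.isAlgebraic_leader [P.IsPrime] (hP : P ∈ Δ.satIdeal.minimalPrimes)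
    (k : Fin Δ.m) :
    IsAlgebraic (Algebra.adjoin ℂ (coord P '' (Δ.freeVars : Set (Fin n)))) (coord P (Δ.z k)) := by
  classical
  set R := Algebra.adjoin ℂ (coord P '' (Δ.freeVars : Set (Fin n)))
  set A := Subalgebra.algebraicClosure R (Poly n ⧸ P)
  induction k using WellFoundedLT.induction with
  | ind k ih =>
    have hlow : ∀ v, (∀ j, k ≤ j → v ≠ Δ.z j) → coord P v ∈ A := by
      intro v hv
      by_cases hfree : v ∈ Δ.freeVars
      · exact isAlgebraic_algebraMap
          (⟨coord P v, Algebra.subset_adjoin ⟨v, hfree, rfl⟩⟩ : R)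
      · simp only [TriangularSet.freeVars, TriangularSet.leaders, Finset.mem_compl,
          Finset.mem_map, Finset.mem_univ, true_and, not_not] at hfree
        obtain ⟨j, rfl⟩ := hfree
        exact ih j (lt_of_not_ge fun h => hv j h rfl)
    let w : Fin n → A := fun v => if h : coord P v ∈ A then ⟨coord P v, h⟩ else 0
    have hw : ∀ v, coord P v ∈ A → algebraMap A (Poly n ⧸ P) (w v) = coord P v := fun v hv => by
      simp only [w, dif_pos hv]
      rfl
    have hvars : ∀ v ∈ (Δ.g k).vars, v ≠ Δ.z k → coord P v ∈ A := by
      intro v hv hne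
      refine hlow v fun j hj h => ?_
      rcases hj.eq_or_lt with rfl | hlt
      · exact hne h
      · exact Δ.not_mem_vars k j hlt (h ▸ hv)
    have halg : IsAlgebraic A (coord P (Δ.z k)) := by
      refine ⟨substExcept w (Δ.z k) (Δ.g k), fun h0 => ?_, ?_⟩
      · have h1 := congrArg (fun q => algebraMap A (Poly n ⧸ P)
          (q.coeff ((Δ.g k).degreeOf (Δ.z k)))) h0
        simp only [coeff_substExcept, Polynomial.coeff_zero, map_zero] at h1
        have h2 : algebraMap A (Poly n ⧸ P) (aeval w (Δ.lc k)) = Ideal.Quotient.mk P (Δ.lc k) := by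
          rw [← aeval_coord, ← IsScalarTower.coe_toAlgHom' ℂ A, MvPolynomial.comp_aeval_apply]
          refine eval₂Hom_congr' rfl (fun v hv _ => ?_) rfl
          have := vars_coeffIn_subset _ _ _ hv
          rw [Finset.mem_sdiff, Finset.mem_singleton] at this
          exact hw v (hvars v this.1 this.2)
        exact Δ.lc_notMem hP k (Ideal.Quotient.eq_zero_iff_mem.1 (h2.symm.trans h1))
      · have h3 : Polynomial.aeval (coord P (Δ.z k)) (substExcept w (Δ.z k) (Δ.g k)) =
            Ideal.Quotient.mk P (Δ.g k) := by
          rw [← aeval_coord]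
          change (((Polynomial.aeval (R := A) (coord P (Δ.z k))).restrictScalars ℂ).comp
            (substExcept w (Δ.z k))) (Δ.g k) = _
          refine hom_congr_vars (f₁ := AlgHom.toRingHom _) (f₂ := AlgHom.toRingHom _) ?_ ?_ rfl
          · ext c
            simp
          · intro v hv _
            by_cases hvz : v = Δ.z k
            · subst hvz
              simp [substExcept]
            · simp [substExcept, Function.update_of_ne hvz, hw v (hvars v hv hvz)]
        rw [h3, Ideal.Quotient.eq_zero_iff_mem]
        exact Δ.g_mem hP k
    by_contra htr
    exact Transcendental.subalgebraAlgebraicClosure htr halg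

/-- The saturated ideal of a triangular set is unmixed: modulo each of its minimal primes the free
variables form a transcendence basis. They generate everything up to algebraic elements, and the
dimension cannot be smaller because the minimal prime is also minimal over the triangular set,
which has only as many elements as there are leaders. -/
theorem TriangularSet.isTranscendenceBasis_freeVars [P.IsPrime]
    (hP : P ∈ Δ.satIdeal.minimalPrimes) :
    IsTranscendenceBasis ℂ (fun b : Δ.freeVars => coord P b.1) := by
  have h1 : Algebra.IsAlgebraic (Algebra.adjoin ℂ (coord P '' (Δ.freeVars : Set (Fin n))))
      (Poly n ⧸ P) := by
    refine isAlgebraic_of_coord P fun i => ?_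
    by_cases hfree : i ∈ Δ.freeVars
    · exact isAlgebraic_algebraMap (⟨coord P i, Algebra.subset_adjoin ⟨i, hfree, rfl⟩⟩ :
        Algebra.adjoin ℂ (coord P '' (Δ.freeVars : Set (Fin n))))
    · simp only [TriangularSet.freeVars, TriangularSet.leaders, Finset.mem_compl,
        Finset.mem_map, Finset.mem_univ, true_and, not_not] at hfree
      obtain ⟨j, rfl⟩ := hfree
      exact Δ.isAlgebraic_leader hP j
  have h2 : Set.range (fun b : Δ.freeVars => coord P b.1) =
      coord P '' (Δ.freeVars : Set (Fin n)) := by ext; simp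
  rw [← h2] at h1
  refine Algebra.IsAlgebraic.isTranscendenceBasis_of_le_trdeg_of_finite ℂ _ ?_
  rw [← cast_quotDim, Cardinal.mk_coe_finset]
  have h3 : P ∈ (Ideal.span (Set.range Δ.g)).minimalPrimes := by
    rw [Δ.satIdeal_eq] at hP
    exact mem_minimalPrimes_of_saturation hP
  have h4 := card_le_ncard_add_quotDim (AlgEquiv.refl) (Set.finite_range Δ.g) h3
  have h5 : (Set.range Δ.g).ncard ≤ Δ.m := by
    rw [← Set.image_univ]
    refine (Set.ncard_image_le Set.finite_univ).trans ?_
    simp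
  have h6 : Δ.freeVars.card = n - Δ.m := by
    rw [TriangularSet.freeVars, Finset.card_compl, TriangularSet.leaders, Finset.card_map]
    simp
  rw [Fintype.card_fin] at h4
  exact_mod_cast (by omega : Δ.freeVars.card ≤ quotDim P)

end Triangular

/-! ### Specialization of the smaller free variables -/

section Specialization

variable {n : ℕ}

lemma algHom_congr_vars {B : Type} [CommRing B] [Algebra ℂ B] (φ ψ : Poly n →ₐ[ℂ] B) {p : Poly n}
    (h : ∀ v ∈ p.vars, φ (X v) = ψ (X v)) : φ p = ψ p := by
  refine hom_congr_vars (f₁ := (φ : Poly n →+* B)) (f₂ := (ψ : Poly n →+* B)) ?_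
    (fun v hv _ => h v hv) rfl
  ext c
  exact (φ.commutes c).trans (ψ.commutes c).symm

lemma le_of_mem_vars_specialize {α : Fin n → ℂ} {i v : Fin n} {p : Poly n}
    (hv : v ∈ (specialize α i p).vars) : v ∈ p.vars ∧ i ≤ v := by
  obtain ⟨l, hl, hlv⟩ := mem_vars_bind₁ _ _ hv
  split_ifs at hlv with h
  · simp at hlv
  · rw [vars_X, Finset.mem_singleton] at hlv
    exact hlv ▸ ⟨hl, not_lt.1 h⟩

/-- If `B` is the greedy basis and `x_i` is not in it, then a polynomial in `x_i` and the variables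
of `B` which vanishes at the generic point continues to do so when the variables below `x_i` are
specialized: these are algebraically independent over the algebraic closure of the field generated
by the variables of `B` above `x_i`, and this closure contains `x_i`. -/
lemma specialize_mem (P : Ideal (Poly n)) [P.IsPrime] {B : Finset (Fin n)}
    (hB : IsGreedy (coordMatroid P) B) {i : Fin n} (hi : i ∉ B) (α : Fin n → ℂ) {p : Poly n}
    (hp : p ∈ P) (hvars : ∀ v ∈ p.vars, v = i ∨ v ∈ B) : specialize α i p ∈ P := by
  classical
  set x : B → Poly n ⧸ P := fun b => coord P b.1
  have hx : AlgebraicIndependent ℂ x := (coordMatroid_indep_iff P).1 hB.1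
  set R := Algebra.adjoin ℂ (x '' {b | i < b.1})
  set A := Subalgebra.algebraicClosure R (Poly n ⧸ P)
  have hlow : AlgebraicIndependent A (fun b : {b : B | b.1 < i} => x b) :=
    (hx.adjoin_of_disjoint (s := {b | i < b.1}) (t := {b | b.1 < i})
      (Set.disjoint_left.2 fun b (h : i < b.1) (h' : b.1 < i) =>
        lt_asymm h h')).subalgebraAlgebraicClosure
  have himage : x '' {b | i < b.1} = coord P '' ((B : Set (Fin n)) ∩ Set.Ioi i) := by
    ext y
    constructor
    · rintro ⟨b, hb, rfl⟩
      exact ⟨b.1, ⟨b.2, hb⟩, rfl⟩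
    · rintro ⟨b, ⟨hb, hib⟩, rfl⟩
      exact ⟨⟨b, hb⟩, hib, rfl⟩
  have hiA : coord P i ∈ A := by
    have := hB.2 i hi
    rw [mem_coordMatroid_closure_iff, ← himage] at this
    exact this
  have hupA : ∀ v ∈ B, i < v → coord P v ∈ A := fun v hv hiv =>
    isAlgebraic_algebraMap (⟨coord P v, Algebra.subset_adjoin ⟨⟨v, hv⟩, hiv, rfl⟩⟩ : R)
  let Θ : Poly n →ₐ[ℂ] MvPolynomial {b : B | b.1 < i} A := aeval fun v =>
    if h : v ∈ B ∧ v < i then X ⟨⟨v, h.1⟩, h.2⟩ else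
      if h : coord P v ∈ A then C ⟨coord P v, h⟩ else 0
  have hΘX : ∀ v (h : v ∈ B ∧ v < i), Θ (X v) = X ⟨⟨v, h.1⟩, h.2⟩ := fun v h => by
    simp [Θ, h]
  have hΘC : ∀ v (_ : ¬ (v ∈ B ∧ v < i)) (hA : coord P v ∈ A), Θ (X v) = C ⟨coord P v, hA⟩ :=
    fun v h hA => by simp only [Θ, aeval_X, dif_neg h, dif_pos hA]
  have hmemA : ∀ v ∈ p.vars, ¬ (v ∈ B ∧ v < i) → coord P v ∈ A := by
    intro v hv h
    rcases hvars v hv with rfl | hvB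
    · exact hiA
    · refine hupA v hvB (lt_of_le_of_ne (not_lt.1 fun hlt => h ⟨hvB, hlt⟩) ?_)
      rintro rfl
      exact hi hvB
  have hΘ0 : Θ p = 0 := by
    apply hlow
    rw [map_zero]
    have := algHom_congr_vars (((aeval fun b : {b : B | b.1 < i} => x b :
        MvPolynomial {b : B | b.1 < i} A →ₐ[A] Poly n ⧸ P).restrictScalars ℂ).comp Θ)
        (Ideal.Quotient.mkₐ ℂ P) (p := p) fun v hv => by
      rw [AlgHom.comp_apply]
      by_cases h : v ∈ B ∧ v < i
      · rw [hΘX v h, AlgHom.restrictScalars_apply, aeval_X]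
        rfl
      · rw [hΘC v h (hmemA v hv h), AlgHom.restrictScalars_apply, aeval_C]
        rfl
    exact this.trans (Ideal.Quotient.eq_zero_iff_mem.2 hp)
  have h1 := algHom_congr_vars (((aeval fun b : {b : B | b.1 < i} =>
      algebraMap ℂ (Poly n ⧸ P) (α b.1) : MvPolynomial {b : B | b.1 < i} A →ₐ[A]
        Poly n ⧸ P).restrictScalars ℂ).comp Θ) ((Ideal.Quotient.mkₐ ℂ P).comp
          (bind₁ fun l => if l < i then C (α l) else X l)) (p := p) fun v hv => by
    rw [AlgHom.comp_apply, AlgHom.comp_apply, bind₁_X_right]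
    by_cases h : v ∈ B ∧ v < i
    · rw [hΘX v h, AlgHom.restrictScalars_apply, aeval_X, if_pos h.2]
      rfl
    · have h2 : ¬ v < i := by
        rcases hvars v hv with rfl | hvB
        · exact lt_irrefl _
        · exact fun hlt => h ⟨hvB, hlt⟩
      rw [hΘC v h (hmemA v hv h), AlgHom.restrictScalars_apply, aeval_C, if_neg h2]
      rfl
  rw [AlgHom.comp_apply] at h1
  rw [hΘ0, map_zero] at h1
  exact Ideal.Quotient.eq_zero_iff_mem.1 h1.symm

/-- A nonzero relation modulo `P` between `x_i` and the variables of an independent set above `x_i`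
necessarily involves `x_i`, which is therefore algebraic over these variables. -/
lemma mem_closure_of_relation (P : Ideal (Poly n)) [P.IsPrime] {B : Finset (Fin n)}
    (hB : (coordMatroid P).Indep B) {i : Fin n} {p : Poly n} (hp : p ∈ P) (hp0 : p ≠ 0)
    (hvars : ∀ v ∈ p.vars, v = i ∨ (v ∈ B ∧ i < v)) :
    i ∈ (coordMatroid P).closure ((B : Set (Fin n)) ∩ Set.Ioi i) := by
  by_contra hcl
  have hind : (coordMatroid P).Indep ((B : Set (Fin n)) ∩ Set.Ioi i) :=
    hB.subset Set.inter_subset_left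
  have h1 := (hind.insert_indep_iff (e := i)).2 (Or.inl ⟨Set.mem_univ i, hcl⟩)
  rw [coordMatroid_indep_iff] at h1
  refine hp0 (algebraicIndependent_comp_subtype (x := coord P)
    (s := insert i ((B : Set (Fin n)) ∩ Set.Ioi i)) |>.1 h1 p ?_ ?_)
  · rw [mem_supported]
    intro v hv
    rcases hvars v hv with h | h
    · exact Or.inl h
    · exact Or.inr h
  · rw [aeval_coord]
    exact Ideal.Quotient.eq_zero_iff_mem.2 hp

end Specialization

/-! ### Components and the output of the zero-dimensional decomposition -/

section Output

variable {n : ℕ} {S : Finset (Fin n)} {h : Fin n → Poly n} {T : Set (Poly n)} {q : ℕ}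
  {Δ : Fin q → TriangularSet n}

lemma subset_Rep_iff {C : Set (Fin n → ℂ)} {Δ : TriangularSet n} :
    C ⊆ Δ.Rep ↔ Δ.satIdeal ≤ idealOf C := subset_zeros_iff

lemma TriangularZeroDimOutput.mem (hout : TriangularZeroDimOutput S h T Δ) (P : Ideal (Poly n))
    [P.IsPrime] (hS : AlgebraicIndependent ℂ (fun i : {i : Fin n // i ∉ S} => coord P i))
    {j : Fin q} (hj : (Δ j).satIdeal ≤ P) {r : Poly n} (hr : r ∈ h '' (S : Set (Fin n)) ∪ T) :
    r ∈ P := by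
  obtain ⟨K, -, hK⟩ := exists_isPrime_toFrac P S hS
  rw [← hK]
  have h1 : (Δ j).satIdeal.map (toFrac S) ≤ K := by
    rw [Ideal.map_le_iff_le_comap]
    exact fun q hq => (hK q).2 (hj hq)
  refine h1 (iInf_le (fun j => (Δ j).satIdeal.map (toFrac S)) j ?_)
  rw [hout.2.2.2.1]
  exact Ideal.le_radical (Ideal.subset_span ⟨r, hr, rfl⟩)

lemma TriangularZeroDimOutput.exists_satIdeal_le (hout : TriangularZeroDimOutput S h T Δ)
    (P : Ideal (Poly n)) [P.IsPrime]
    (hS : AlgebraicIndependent ℂ (fun i : {i : Fin n // i ∉ S} => coord P i))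
    (hP : ∀ r ∈ h '' (S : Set (Fin n)) ∪ T, r ∈ P) : ∃ j, (Δ j).satIdeal ≤ P := by
  obtain ⟨K, hKprime, hK⟩ := exists_isPrime_toFrac P S hS
  have h1 : (fracIdeal S h T).radical ≤ K := by
    rw [hKprime.radical_le_iff, fracIdeal, Ideal.span_le]
    rintro _ ⟨r, hr, rfl⟩
    exact (hK r).2 (hP r hr)
  rw [← hout.2.2.2.1] at h1
  rw [← Finset.inf_univ_eq_iInf] at h1
  obtain ⟨j, -, hj⟩ := (Ideal.IsPrime.inf_le' hKprime).1 h1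
  exact ⟨j, fun q hq => (hK q).1 (hj (Ideal.mem_map_of_mem _ hq))⟩

end Output

/-! ### The generalized resultants of the squared system -/

section Squared

variable {n s : ℕ}

lemma vars_ghat_subset (f : Fin s → Poly n) (lam : ℕ → Fin s → ℂ) (S : Finset (Fin n)) :
    (ghat f lam S).vars ⊆ Sᶜ := vars_PRes_subset _ _

lemma squared_mem {f : Fin s → Poly n} {I : Ideal (Poly n)} (hf : ∀ j, f j ∈ I)
    (lam : ℕ → Fin s → ℂ) (l : ℕ) : squared f lam l ∈ I :=
  I.sum_mem fun j _ => I.mul_mem_left _ (hf j)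

/-- The positions at which the first `|T| + 1` squared polynomials enter the perturbed system. -/
lemma exists_position (T : Finset (Fin n)) {l : ℕ} (hl : l < T.card + 1) :
    ∃ o : Option T, o.elim T.card (fun i => (T.filter (· < i.1)).card) = l := by
  rcases Nat.lt_succ_iff_lt_or_eq.1 hl with hl | rfl
  · let φ : T → Fin T.card := fun i => ⟨(T.filter (· < i.1)).card, Finset.card_lt_card
      (Finset.filter_ssubset.2 ⟨i.1, i.2, lt_irrefl _⟩)⟩
    have hmono : StrictMono φ := fun i i' hii' => Finset.card_lt_card <| by
      refine ⟨fun v hv => ?_, fun h => ?_⟩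
      · rw [Finset.mem_filter] at hv ⊢
        exact ⟨hv.1, hv.2.trans hii'⟩
      · have := h (Finset.mem_filter.2 ⟨i.2, hii'⟩)
        simp at this
    obtain ⟨i, hi⟩ := ((Fintype.bijective_iff_injective_and_card φ).2
      ⟨hmono.injective, by simp⟩).2 ⟨l, hl⟩
    exact ⟨some i, congrArg Fin.val hi⟩
  · exact ⟨none, rfl⟩

/-- Under the assumption on the components of the squared system, all generalized resultants of
the size that matches the dimension of a component vanish on it. -/
lemma ghat_mem {f : Fin s → Poly n} {lam : ℕ → Fin s → ℂ} {C : Set (Fin n → ℂ)}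
    (hC : IsComponent C (zeros (Set.range f))) (T : Finset (Fin n))
    (hT : T.card + 1 + quotDim (idealOf C) = n)
    (hA1 : ∀ (Y : Set (Fin n → ℂ)) (e : ℕ), HasDim Y e → n < e + (T.card + 1) →
      IsComponent Y (zeros {q | ∃ l < T.card + 1, q = squared f lam l}) →
        IsComponent Y (zeros (Set.range f))) :
    ghat f lam T ∈ idealOf C := by
  have hprime := hC.1.1.isPrime
  have hf : ∀ j, f j ∈ idealOf C := fun j => subset_zeros_iff.1 hC.1.2 ⟨j, rfl⟩
  refine PRes_mem T _ _ (fun o => squared_mem hf _ _) fun Q hQ hQC hFQ => ?_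
  by_contra hdim
  have hle : Ideal.span {q | ∃ l < T.card + 1, q = squared f lam l} ≤ Q := by
    rw [Ideal.span_le]
    rintro _ ⟨l, hl, rfl⟩
    obtain ⟨o, ho⟩ := exists_position T hl
    exact ho ▸ hFQ o
  obtain ⟨P, hP, hPQ⟩ := Ideal.exists_minimalPrimes_le hle
  have hPprime := hP.isPrime
  have h1 := quotDim_anti hPQ
  have h2 := hA1 _ (quotDim P) (hasDim_iff.2 (by rw [idealOf_zeros])) (by omega)
    (isComponent_zeros hP)
  have h3 := hC.eq_zeros h2.1.2 (hPQ.trans hQC)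
  rw [h3] at hT
  omega

end Squared

/-! ### Chains and components -/

section Chains

variable {n : ℕ} {S : Finset (Fin n)} {h : Fin n → Poly n} {T : Set (Poly n)} {q : ℕ}
  {Δ : Fin q → TriangularSet n}

lemma freeVars_eq (hout : TriangularZeroDimOutput S h T Δ) (j : Fin q) :
    (Δ j).freeVars = Sᶜ := by
  rw [TriangularSet.freeVars, hout.2.1 j]

lemma algebraicIndependent_compl {P : Ideal (Poly n)} [P.IsPrime]
    (hS : (coordMatroid P).Indep ((Sᶜ : Finset (Fin n)) : Set (Fin n))) :
    AlgebraicIndependent ℂ (fun i : {i : Fin n // i ∉ S} => coord P i) :=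
  ((coordMatroid_indep_iff P).1 hS).comp
    (fun i : {i : Fin n // i ∉ S} => (⟨i.1, by simp⟩ :
      (((Sᶜ : Finset (Fin n)) : Set (Fin n)))))
    fun i i' hii' => Subtype.ext (congrArg (fun v => v.1) hii')

/-- If the free variables are algebraically independent modulo the ideal of the component `C`, and
`T` defines a subset of `V`, then `C` is a component of every zero set of a chain which
contains it. -/
lemma isComponent_Rep (hout : TriangularZeroDimOutput S h T Δ) {C V : Set (Fin n → ℂ)}
    (hC : IsComponent C V) (hT : zeros T ⊆ V) [(idealOf C).IsPrime]
    (hS : (coordMatroid (idealOf C)).Indep ((Sᶜ : Finset (Fin n)) : Set (Fin n))) {j : Fin q}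
    (hCj : C ⊆ (Δ j).Rep) : IsComponent C (Δ j).Rep := by
  refine ⟨⟨hC.1.1, hCj⟩, fun A ⟨hA, hAj⟩ hCA => ?_⟩
  have hprime := hA.isPrime
  have hle : idealOf A ≤ idealOf C := (idealOf_le_iff hA.1).1 hCA
  have hind : (coordMatroid (idealOf A)).Indep ((Sᶜ : Finset (Fin n)) : Set (Fin n)) := by
    rw [coordMatroid_indep_iff] at hS ⊢
    exact AlgebraicIndependent.of_comp (Ideal.Quotient.factorₐ ℂ hle) hS
  have hTA : T ⊆ idealOf A := fun r hr =>
    hout.mem (idealOf A) (algebraicIndependent_compl hind) (subset_Rep_iff.1 hAj) (Or.inr hr)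
  exact hC.2 ⟨hA, (subset_zeros_iff.2 hTA).trans hT⟩ hCA

/-- A component of `V` contained in the zero set of a chain is the zero set of a minimal prime of
the saturated ideal. -/
lemma idealOf_mem_minimalPrimes (hout : TriangularZeroDimOutput S h T Δ) {C V : Set (Fin n → ℂ)}
    (hC : IsComponent C V) (hT : zeros T ⊆ V) {j : Fin q} (hCj : C ⊆ (Δ j).Rep) :
    idealOf C ∈ (Δ j).satIdeal.minimalPrimes := by
  have := hC.1.1.isPrime
  obtain ⟨P, hP, hPC⟩ := Ideal.exists_minimalPrimes_le (subset_Rep_iff.1 hCj)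
  have hPprime := hP.isPrime
  have hind : (coordMatroid P).Indep ((Sᶜ : Finset (Fin n)) : Set (Fin n)) := by
    rw [← freeVars_eq hout j, coordMatroid_indep_iff]
    exact (TriangularSet.isTranscendenceBasis_freeVars hP).1
  have hTP : T ⊆ P := fun r hr =>
    hout.mem P (algebraicIndependent_compl hind) hP.le (Or.inr hr)
  rw [hC.eq_zeros ((zeros_anti hTP).trans hT) hPC]
  exact hP

end Chains

end TriDec

end

open TriDec

theorem mainTheorem2 (n s : ℕ) (f : Fin s → TriDec.Poly n)
    -- the variety `W` and the extreme dimensions of its components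
    (W : Set (Fin n → ℂ)) (hW : W = TriDec.zeros (Set.range f))
    (d₀ d₁ : ℕ) (hd₀ : IsLeast (TriDec.componentDims W) d₀)
    (hd₁ : IsGreatest (TriDec.componentDims W) d₁)
    -- equations of the equidimensional parts
    (p : ℕ → Fin (n + 1) → TriDec.Poly n)
    (hp : ∀ d, d₀ ≤ d → d ≤ d₁ → TriDec.zeros (Set.range (p d)) = TriDec.equidimPart W d)
    -- squaring the system, and assumption A1 on the first `k = n - d` squared polynomials
    (lam : ℕ → Fin s → ℂ)
    (hA1 : ∀ k, 1 ≤ k → k + d₀ ≤ n + 1 → ∀ (C : Set (Fin n → ℂ)) (e : ℕ),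
      TriDec.HasDim C e → n < e + k →
      (TriDec.IsComponent C (TriDec.zeros {q | ∃ l < k, q = TriDec.squared f lam l}) ↔
        TriDec.IsComponent C W))
    -- the random point, and assumption A2
    (α : Fin n → ℂ)
    (hA2 : ∀ S : Finset (Fin n), n ≤ S.card + 1 + d₁ → S.card + 1 + d₀ ≤ n →
      MvPolynomial.eval α (TriDec.ghat f lam S) ≠ 0)
    -- the polynomials `g_{S, j}`, indexed by `i = i_j ∈ S`
    (g : Finset (Fin n) → Fin n → TriDec.Poly n)
    (hg : ∀ S : Finset (Fin n), n ≤ S.card + d₁ → S.card + d₀ ≤ n → ∀ i ∈ S,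
      TriDec.IsSquarefreePart S
        (TriDec.specialize α i (TriDec.ghat f lam (S.erase i))) (g S i))
    -- the chains returned by the calls of `TriangularZeroDim`, which meets its specification
    (q : Finset (Fin n) → ℕ) (Δ : (S : Finset (Fin n)) → Fin (q S) → TriDec.TriangularSet n)
    (hΔ : ∀ S : Finset (Fin n), n ≤ S.card + d₁ → S.card + d₀ ≤ n →
      TriDec.TriangularZeroDimInput S (g S) (Set.range (p (n - S.card))) →
      TriDec.TriangularZeroDimOutput S (g S) (Set.range (p (n - S.card))) (Δ S))
    (C : Set (Fin n → ℂ)) (hC : TriDec.IsComponent C W) :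
    -- output chains are indexed by the pairs `(S, j)` with `n - d₁ ≤ |S| ≤ n - d₀`
    ∃ c : Σ S : {S : Finset (Fin n) // n ≤ S.card + d₁ ∧ S.card + d₀ ≤ n}, Fin (q S.1),
      C ⊆ (Δ c.1.1 c.2).Rep ∧
      (∀ c' : Σ S : {S : Finset (Fin n) // n ≤ S.card + d₁ ∧ S.card + d₀ ≤ n}, Fin (q S.1),
        C ⊆ (Δ c'.1.1 c'.2).Rep → c' = c) ∧
      TriDec.IsComponent C (Δ c.1.1 c.2).Rep ∧
      TriDec.IsLexMaxTransBasis C (Δ c.1.1 c.2).freeVars := by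
  have hprime := hC.1.1.isPrime
  have hvars : ∀ S : Finset (Fin n), n ≤ S.card + d₁ → S.card + d₀ ≤ n → ∀ i ∈ S,
      ∀ v ∈ (g S i).vars, v = i ∨ (v ∈ Sᶜ ∧ i < v) := by
    intro S h1 h2 i hi v hv
    have h3 := le_of_mem_vars_specialize ((hg S h1 h2 i hi).1 hv)
    have h4 := vars_ghat_subset _ _ _ h3.1
    rw [Finset.mem_compl, Finset.mem_erase, not_and_or, not_not] at h4
    by_cases hvi : v = i
    · exact Or.inl hvi
    · exact Or.inr ⟨Finset.mem_compl.2 (h4.resolve_left hvi), lt_of_le_of_ne h3.2 (Ne.symm hvi)⟩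
  have hout : ∀ S : Finset (Fin n), n ≤ S.card + d₁ → S.card + d₀ ≤ n →
      TriangularZeroDimOutput S (g S) (Set.range (p (n - S.card))) (Δ S) := by
    intro S h1 h2
    refine hΔ S h1 h2 (triangularZeroDimInput _ _ _ (fun i hi v hv => ?_) fun i hi =>
      (hg S h1 h2 i hi).2.1)
    exact (hvars S h1 h2 i hi v hv).imp_right fun h => Finset.mem_compl.1 h.1
  have hpW : ∀ S : Finset (Fin n), n ≤ S.card + d₁ → S.card + d₀ ≤ n →
      zeros (Set.range (p (n - S.card))) = equidimPart W (n - S.card) := fun S h1 h2 =>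
    hp _ (by omega) (by omega)
  have hpW' : ∀ S : Finset (Fin n), n ≤ S.card + d₁ → S.card + d₀ ≤ n →
      zeros (Set.range (p (n - S.card))) ⊆ W := by
    intro S h1 h2
    rw [hpW S h1 h2]
    rintro x ⟨C', hC', -, hx⟩
    exact hC'.1.2 hx
  -- the complement of the greedy basis is the set of leaders of the chain that represents `C`
  obtain ⟨B, hB⟩ := exists_isGreedy (coordMatroid (idealOf C)) (coordMatroid_ground _)
  have hcard := card_eq_quotDim _ hB.isTranscendenceBasis
  have hdim : HasDim C (quotDim (idealOf C)) := hasDim_iff.2 rfl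
  have hle₀ : d₀ ≤ quotDim (idealOf C) := hd₀.2 ⟨C, hC, hdim⟩
  have hle₁ : quotDim (idealOf C) ≤ d₁ := hd₁.2 ⟨C, hC, hdim⟩
  have hBn : B.card ≤ n := by simpa using B.card_le_univ
  have hScard : (Bᶜ).card = n - B.card := by rw [Finset.card_compl, Fintype.card_fin]
  have hr₁ : n ≤ (Bᶜ).card + d₁ := by omega
  have hr₀ : (Bᶜ).card + d₀ ≤ n := by omega
  have hind : (coordMatroid (idealOf C)).Indep ((Bᶜᶜ : Finset (Fin n)) : Set (Fin n)) := by
    rw [compl_compl]; exact hB.1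
  have hgC : ∀ r ∈ g Bᶜ '' ((Bᶜ : Finset (Fin n)) : Set (Fin n)) ∪
      Set.range (p (n - (Bᶜ).card)), r ∈ idealOf C := by
    rintro r (⟨i, hi, rfl⟩ | ⟨k, rfl⟩)
    · have hi' : i ∈ Bᶜ := hi
      have h1 : ((Bᶜ).erase i).card + 1 = (Bᶜ).card := Finset.card_erase_add_one hi'
      have h2 : ghat f lam ((Bᶜ).erase i) ∈ idealOf C := by
        subst hW
        exact ghat_mem hC _ (by omega) fun Y e hY he hYV =>
          (hA1 _ (by omega) (by omega) Y e hY he).1 hYV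
      have h3 := specialize_mem (idealOf C) hB (Finset.mem_compl.1 hi') α h2 fun v hv => by
        have := vars_ghat_subset _ _ _ hv
        rw [Finset.mem_compl, Finset.mem_erase, not_and_or, not_not, Finset.mem_compl,
          not_not] at this
        exact this
      obtain ⟨K, hK, hKC⟩ := exists_isPrime_toFrac (idealOf C) Bᶜ (algebraicIndependent_compl hind)
      obtain ⟨-, -, -, N, hN⟩ := hg Bᶜ hr₁ hr₀ i hi'
      rw [← hKC] at h3 ⊢
      exact hK.mem_of_pow_mem N (K.mem_of_dvd hN h3)
    · have : C ⊆ zeros (Set.range (p (n - (Bᶜ).card))) := by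
        rw [hpW _ hr₁ hr₀]
        intro x hx
        exact ⟨C, hC, hasDim_iff.2 (by omega), hx⟩
      exact subset_zeros_iff.1 this ⟨k, rfl⟩
  obtain ⟨j, hj⟩ := (hout _ hr₁ hr₀).exists_satIdeal_le (idealOf C)
    (algebraicIndependent_compl hind) hgC
  have hcomp : IsComponent C (Δ Bᶜ j).Rep :=
    isComponent_Rep (hout _ hr₁ hr₀) hC (hpW' _ hr₁ hr₀) hind (subset_Rep_iff.2 hj)
  refine ⟨⟨⟨Bᶜ, hr₁, hr₀⟩, j⟩, subset_Rep_iff.2 hj, ?_, hcomp, ?_⟩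
  · rintro ⟨⟨S, h₁, h₀⟩, j'⟩ hCj'
    have hmin := idealOf_mem_minimalPrimes (hout S h₁ h₀) hC (hpW' S h₁ h₀) hCj'
    have hbasis := TriangularSet.isTranscendenceBasis_freeVars hmin
    rw [freeVars_eq (hout S h₁ h₀) j'] at hbasis
    have hindS : (coordMatroid (idealOf C)).Indep ((Sᶜ : Finset (Fin n)) : Set (Fin n)) :=
      (coordMatroid_indep_iff _).2 hbasis.1
    have hgreedy : IsGreedy (coordMatroid (idealOf C)) Sᶜ := by
      refine ⟨hindS, fun i hi => ?_⟩
      have hiS : i ∈ S := by simpa using hi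
      refine mem_closure_of_relation (idealOf C) hindS (p := g S i) ?_ ?_
        (hvars S h₁ h₀ i hiS)
      · exact (hout S h₁ h₀).mem (idealOf C) (algebraicIndependent_compl hindS)
          (subset_Rep_iff.1 hCj') (Or.inl ⟨i, hiS, rfl⟩)
      · intro h0
        have := (hg S h₁ h₀ i hiS).2.1
        rw [h0, map_zero] at this
        exact not_squarefree_zero this
    obtain rfl : S = Bᶜ := by rw [hB.eq hgreedy, compl_compl]
    have hcomp' := isComponent_Rep (hout _ h₁ h₀) hC (hpW' _ h₁ h₀) hindS hCj'
    obtain rfl : j' = j := by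
      by_contra hne
      exact (hout _ h₁ h₀).2.2.1 j' j hne ⟨C, hcomp', hcomp⟩
    rfl
  · change IsLexMaxTransBasis C (Δ Bᶜ j).freeVars
    rw [freeVars_eq (hout _ hr₁ hr₀) j, compl_compl]
    exact isLexMaxTransBasis_of_isGreedy hB
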